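/- Graphs are finite and loopless, but may have multiple edges. A plane graph is a graph drawn in the Euclidean plane: its vertices are points, its edges are arcs joining two distinct vertices and containing no other vertex, and two different edges meet only in vertices. Its faces are the connected components of the complement of the drawing; a vertex is incident with a face if it lies on the boundary of the face, and the degree $\deg_G(f)$ of a face $f$ of $G$ is the number of vertices incident with $f$. A cyclic coloring of $G$ is a coloring of its vertices in which any two different vertices incident with the same face receive different colors, and $\chi_c(G)$ is the minimum number of colors in a cyclic coloring of $G$. A subdivision of a plane graph $R$ is a plane graph obtained from $R$ by a finite sequence of steps, each of which places a new vertex in the interior of an edge and replaces that edge with the two arcs into which the vertex divides it. A subdivision $G$ of $R$ is the same subset of the plane as $R$ and so has the same faces; for a face $f$ of $G$ let $f'$ be the corresponding face of $R$, i.e. the same region regarded as a face of $R$. A graph is $3$-connected if it has at least four vertices and deleting at most two vertices always leaves a connected graph. Theorem. If $G$ is a subdivision of a $3$-connected plane graph $R$, then $$\chi_c(G)\le \Big\lfloor \tfrac32 \max_{f\in F(G)}\{\deg_G(f)-\deg_R(f')\}\Big\rfloor+\chi_c(R),$$ where $F(G)$ is the set of faces of $G$. Moreover, the bound is tight: for every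 integer $a\ge 2$ there are a simple $3$-connected plane graph $R$ and a subdivision $G$ of $R$ with $\max_{f\in F(G)}\{\deg_G(f)-\deg_R(f')\}=2a$ for which equality holds. -/

import Mathlib

open Set

/-- `A` is an arc in the plane (identified with `ℂ`) with end points `u` and `v`: the image of an
injective path from `u` to `v`. In particular `u ≠ v`. -/
def IsArc (u v : ℂ) (A : Set ℂ) : Prop :=
  ∃ γ : Path u v, Function.Injective γ ∧ range γ = A

/-- A finite plane graph. The vertices are points of the plane and the edges are arcs; an edge joins
two (distinct) vertices and contains no other vertex, and two different edges meet only in vertices.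
Several edges may have the same two ends; there are no loops. -/
structure PlaneGraph where
  verts : Set ℂ
  edges : Set (Set ℂ)
  verts_finite : verts.Finite
  edges_finite : edges.Finite
  edge_isArc : ∀ e ∈ edges, ∃ u v : ℂ, IsArc u v e ∧ e ∩ verts = {u, v}
  edge_inter : ∀ e ∈ edges, ∀ e' ∈ edges, e ≠ e' → e ∩ e' ⊆ verts

namespace PlaneGraph

/-- The adjacency relation of a plane graph. -/
def adjGraph (G : PlaneGraph) : SimpleGraph G.verts where
  Adj u v := u ≠ v ∧ ∃ e ∈ G.edges, e ∩ G.verts = {(u : ℂ), (v : ℂ)}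
  symm := ⟨fun u v h => ⟨h.1.symm, by
    obtain ⟨e, he, h'⟩ := h.2
    exact ⟨e, he, by rw [h', pair_comm]⟩⟩⟩
  loopless := ⟨fun _ h => h.1 rfl⟩

/-- No two edges have the same ends. -/
def IsSimple (G : PlaneGraph) : Prop :=
  ∀ e ∈ G.edges, ∀ e' ∈ G.edges, e ∩ G.verts = e' ∩ G.verts → e = e'

/-- At least four vertices, and deleting at most two vertices leaves a connected graph. -/
def IsThreeConnected (G : PlaneGraph) : Prop :=
  4 ≤ G.verts.ncard ∧
    ∀ X : Set G.verts, X.ncard ≤ 2 → (G.adjGraph.induce Xᶜ).Connected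

/-- The set of all points of the plane that lie on the graph. -/
def support (G : PlaneGraph) : Set ℂ :=
  G.verts ∪ ⋃₀ G.edges

/-- The faces: the connected components of the complement of the graph in the plane. -/
def faces (G : PlaneGraph) : Set (Set ℂ) :=
  {f | ∃ x ∈ G.supportᶜ, f = connectedComponentIn G.supportᶜ x}

/-- The set of vertices incident with a face, i.e. lying on its boundary. -/
def faceVerts (G : PlaneGraph) (f : Set ℂ) : Set ℂ :=
  G.verts ∩ frontier f

/-- The degree of a face: the number of vertices incident with it. -/
noncomputable def faceDegree (G : PlaneGraph) (f : Set ℂ) : ℕ :=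
  (G.faceVerts f).ncard

/-- Any two different vertices incident with the same face receive different colors. -/
def IsCyclicColoring (G : PlaneGraph) {C : Type} (c : G.verts → C) : Prop :=
  ∀ f ∈ G.faces, ∀ u v : G.verts, (u : ℂ) ∈ G.faceVerts f → (v : ℂ) ∈ G.faceVerts f →
    u ≠ v → c u ≠ c v

/-- The cyclic chromatic number: the least number of colors in a cyclic coloring. -/
noncomputable def cyclicChromaticNumber (G : PlaneGraph) : ℕ :=
  sInf {k : ℕ | ∃ c : G.verts → Fin k, G.IsCyclicColoring c}

/-- `G` arises from `R` by subdividing one edge `e`, with ends `u` and `v`: a new vertex `w` is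
placed on `e`, and `e` is replaced with its two parts `e₁` from `u` to `w` and `e₂` from `w` to
`v`. -/
def SubdivisionStep (R G : PlaneGraph) : Prop :=
  ∃ e ∈ R.edges, ∃ (u v w : ℂ) (e₁ e₂ : Set ℂ),
    e ∩ R.verts = {u, v} ∧ w ∈ e ∧ w ∉ R.verts ∧
    IsArc u w e₁ ∧ IsArc w v e₂ ∧ e₁ ∪ e₂ = e ∧ e₁ ∩ e₂ = {w} ∧
    G.verts = insert w R.verts ∧ G.edges = (R.edges \ {e}) ∪ {e₁, e₂}

/-- `G` is a subdivision of `R`: it arises from `R` by a finite sequence of subdivisions of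
edges. -/
def IsSubdivision (G R : PlaneGraph) : Prop :=
  Relation.ReflTransGen SubdivisionStep R G

theorem SubdivisionStep.support_eq {R G : PlaneGraph} (h : SubdivisionStep R G) :
    G.support = R.support := by
  obtain ⟨e, he, u, v, w, e₁, e₂, -, hw, -, -, -, hu, -, hV, hE⟩ := h
  have hRE : ⋃₀ R.edges = ⋃₀ (R.edges \ {e}) ∪ e := by
    conv_lhs => rw [← sdiff_union_of_subset (singleton_subset_iff.2 he)]
    rw [sUnion_union, sUnion_singleton]
  have hGE : ⋃₀ G.edges = ⋃₀ R.edges := by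
    rw [hE, sUnion_union, sUnion_pair, hu, hRE]
  rw [support, support, hGE, hV, insert_union, insert_eq_of_mem]
  exact Or.inr ⟨e, he, hw⟩

/-- A subdivision has the same point set, hence the same faces: the face of `R` that corresponds to
a face `f` of `G` is the same region `f` of the plane. -/
theorem IsSubdivision.faces_eq {G R : PlaneGraph} (h : G.IsSubdivision R) :
    G.faces = R.faces := by
  have hs : G.support = R.support := by
    induction h with
    | refl => rfl
    | tail _ hstep ih => rw [hstep.support_eq, ih]
  rw [faces, faces, hs]

/-- The set of all differences `deg_G(f) - deg_R(f')`, where `f` is a face of `G` and `f'` is the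
corresponding face of the graph `R` of which `G` is a subdivision; as regions of the plane,
`f' = f`. -/
def degreeDifferences (G R : PlaneGraph) : Set ℤ :=
  {d | ∃ f ∈ G.faces, d = (G.faceDegree f : ℤ) - (R.faceDegree f : ℤ)}

end PlaneGraph

/-!
A point of an edge that is not a vertex is incident with one or two faces. The new vertices of `G`
are therefore the edges of a multigraph (with half-edges) whose vertices are the faces, and the
degree of a face `f` in it is `deg_G(f) - deg_R(f')`. A proper edge coloring of this multigraph
colors the new vertices, with colors that do not occur in an optimal cyclic coloring of the old
ones, and by Shannon's theorem `⌊3D/2⌋` colors suffice if all its degrees are at most `D`.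
Shannon's theorem follows by extending a coloring edge by edge: at an edge to which it cannot be
extended, even after interchanges along Kempe chains, the sets of colors missing at three vertices
are disjoint, which leaves room for too few colors.

That at most two faces meet at a point of an edge is a separation property of arcs, proved with
continuous logarithms: `z - a` has no continuous logarithm on the boundary of a bounded region
around `a`, while for three points `a`, `b`, `c` separated only by the arc there are exponents,
not all zero and with sum zero, for which `(z - a) ^ k * (z - b) ^ l * (z - c) ^ m` has one on the
whole drawing, and two of the three points would have to lie in the unbounded region.

The bound is attained by the complete graph on four vertices whose three edges at one vertex are
subdivided `a` times each: any two vertices of the subdivision lie on a common face, and each of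
the three faces at that vertex has received `2 * a` new ones.
-/

/-! ### Continuous logarithms -/

section Logarithm

variable {X : Type*} [TopologicalSpace X] {f g u v : X → ℂ} {A B K : Set X}

/-- `u` is a continuous logarithm of `f` on `K`. -/
def IsLogOn (u f : X → ℂ) (K : Set X) : Prop :=
  ContinuousOn u K ∧ ∀ z ∈ K, Complex.exp (u z) = f z

/-- `f` has a continuous logarithm on `K`; in particular `f` does not vanish on `K`. -/
def HasLogOn (f : X → ℂ) (K : Set X) : Prop :=
  ∃ u, IsLogOn u f K

namespace IsLogOn

theorem mono (hu : IsLogOn u f B) (h : A ⊆ B) : IsLogOn u f A :=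
  ⟨hu.1.mono h, fun z hz => hu.2 z (h hz)⟩

theorem congr (hu : IsLogOn u f K) (h : EqOn f g K) : IsLogOn u g K :=
  ⟨hu.1, fun z hz => (hu.2 z hz).trans (h hz)⟩

theorem mul (hu : IsLogOn u f K) (hv : IsLogOn v g K) : IsLogOn (u + v) (f * g) K :=
  ⟨hu.1.add hv.1, fun z hz => by simp [Complex.exp_add, hu.2 z hz, hv.2 z hz]⟩

theorem zpow (hu : IsLogOn u f K) (n : ℤ) : IsLogOn (n • u) (f ^ n) K :=
  ⟨hu.1.const_smul n, fun z hz => by simp [Complex.exp_int_mul, hu.2 z hz]⟩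

theorem exists_int_sub_eq (hu : IsLogOn u f A) (hv : IsLogOn v f B) {z : X} (hz : z ∈ A ∩ B) :
    ∃ n : ℤ, u z - v z = n * (2 * Real.pi * Complex.I) := by
  obtain ⟨n, hn⟩ := Complex.exp_eq_exp_iff_exists_int.1 ((hu.2 z hz.1).trans (hv.2 z hz.2).symm)
  exact ⟨n, sub_eq_iff_eq_add'.2 hn⟩

/-- Adding a constant to `v` makes it agree with `u` on `A ∩ B`, so that the two can be glued. -/
theorem hasLogOn_union (hu : IsLogOn u f A) (hv : IsLogOn v f B) (hA : IsClosed A)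
    (hB : IsClosed B) {n : ℤ} (h : ∀ z ∈ A ∩ B, u z - v z = n * (2 * Real.pi * Complex.I)) :
    HasLogOn f (A ∪ B) := by
  classical
  let v' : X → ℂ := fun z => v z + n * (2 * Real.pi * Complex.I)
  have hwA : EqOn (A.piecewise u v') u A := piecewise_eqOn A u v'
  have hwB : EqOn (A.piecewise u v') v' B := fun z hz => by
    by_cases hzA : z ∈ A
    · rw [hwA hzA]
      exact sub_eq_iff_eq_add'.1 (h z ⟨hzA, hz⟩)
    · exact piecewise_eq_of_notMem _ _ _ hzA
  refine ⟨A.piecewise u v', (hu.1.congr hwA).union_of_isClosed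
    ((hv.1.add continuousOn_const).congr hwB) hA hB, ?_⟩
  rintro z (hz | hz)
  · rw [hwA hz, hu.2 z hz]
  · rw [hwB hz, Complex.exp_add, hv.2 z hz, Complex.exp_int_mul_two_pi_mul_I, mul_one]

end IsLogOn

namespace HasLogOn

theorem mono (hf : HasLogOn f B) (h : A ⊆ B) : HasLogOn f A :=
  hf.imp fun _ hu => hu.mono h

theorem congr (hf : HasLogOn f K) (h : EqOn f g K) : HasLogOn g K :=
  hf.imp fun _ hu => hu.congr h

theorem mul (hf : HasLogOn f K) (hg : HasLogOn g K) : HasLogOn (f * g) K :=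
  let ⟨_, hu⟩ := hf
  let ⟨_, hv⟩ := hg
  ⟨_, hu.mul hv⟩

theorem zpow (hf : HasLogOn f K) (n : ℤ) : HasLogOn (f ^ n) K :=
  let ⟨_, hu⟩ := hf
  ⟨_, hu.zpow n⟩

/-- Two logarithms of `f` on `A` and `B` differ by integer multiples `m`, `n` of `2πi` at the two
points of `A ∩ B`; those of a product of powers of `f` and `g` can be glued if these integers
agree, which is one linear condition on the two exponents. -/
theorem exists_zpow_mul_zpow_union {x y : X} (hA : IsClosed A) (hB : IsClosed B)
    (hAB : A ∩ B = {x, y}) (hfA : HasLogOn f A) (hfB : HasLogOn f B) (hgA : HasLogOn g A)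
    (hgB : HasLogOn g B) :
    ∃ p q : ℤ, (p ≠ 0 ∨ q ≠ 0) ∧ HasLogOn (f ^ p * g ^ q) (A ∪ B) := by
  obtain ⟨u, hu⟩ := hfA
  obtain ⟨v, hv⟩ := hfB
  obtain ⟨u', hu'⟩ := hgA
  obtain ⟨v', hv'⟩ := hgB
  have hx : x ∈ A ∩ B := hAB ▸ mem_insert x _
  have hy : y ∈ A ∩ B := hAB ▸ mem_insert_of_mem x rfl
  obtain ⟨m, hm⟩ := hu.exists_int_sub_eq hv hx
  obtain ⟨n, hn⟩ := hu.exists_int_sub_eq hv hy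
  obtain ⟨m', hm'⟩ := hu'.exists_int_sub_eq hv' hx
  obtain ⟨n', hn'⟩ := hu'.exists_int_sub_eq hv' hy
  obtain ⟨p, q, hpq, h⟩ : ∃ p q : ℤ, (p ≠ 0 ∨ q ≠ 0) ∧ p * m + q * m' = p * n + q * n' := by
    by_cases h : m = n
    · exact ⟨1, 0, .inl one_ne_zero, by simpa using h⟩
    · exact ⟨n' - m', m - n, .inr (sub_ne_zero.2 h), by ring⟩
  refine ⟨p, q, hpq, ((hu.zpow p).mul (hu'.zpow q)).hasLogOn_union ((hv.zpow p).mul (hv'.zpow q))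
    hA hB (n := p * m + q * m') ?_⟩
  have hsub (z : X) : (p • u + q • u') z - (p • v + q • v') z =
      p * (u z - v z) + q * (u' z - v' z) := by
    simp only [Pi.add_apply, Pi.smul_apply]
    simp only [zsmul_eq_mul]
    ring
  rw [hAB]
  rintro z (rfl | rfl)
  · rw [hsub, hm, hm']
    push_cast
    ring
  · rw [hsub, hn, hn', h]
    push_cast
    ring

end HasLogOn

theorem hasLogOn_univ [SimplyConnectedSpace X] [LocallyPathConnectedSpace X] (hf : Continuous f)
    (h0 : ∀ x, f x ≠ 0) : HasLogOn f univ := by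
  obtain ⟨x⟩ : Nonempty X := inferInstance
  obtain ⟨u, ⟨-, hu⟩, -⟩ := Complex.isCoveringMapOn_exp.existsUnique_continuousMap_lifts
    ⟨f, hf⟩ (Complex.exp_log (h0 x)) h0
  exact ⟨u, u.continuous.continuousOn, fun z _ => congrFun hu z⟩

theorem hasLogOn_range {Y : Type*} [TopologicalSpace Y] [SimplyConnectedSpace Y]
    [LocallyPathConnectedSpace Y] {γ : Y → X} (hγ : Topology.IsEmbedding γ)
    (hf : ContinuousOn f (range γ)) (h0 : ∀ x ∈ range γ, f x ≠ 0) : HasLogOn f (range γ) := by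
  obtain ⟨u, hu, hfu⟩ := hasLogOn_univ (f := f ∘ γ)
    (hf.comp_continuous hγ.continuous mem_range_self) fun y => h0 _ (mem_range_self y)
  refine ⟨Function.extend γ u 0, ?_, ?_⟩
  · rw [← image_univ]
    refine hγ.isInducing.continuousOn_image_iff.2 ?_
    rwa [Function.extend_comp hγ.injective]
  · rintro _ ⟨y, rfl⟩
    rw [hγ.injective.extend_apply, hfu y trivial, Function.comp_apply]

end Logarithm

theorem not_hasLogOn_sphere (a : ℂ) {r : ℝ} (hr : 0 < r) {k : ℤ} (hk : k ≠ 0) :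
    ¬ HasLogOn (fun z => (z - a) ^ k) (Metric.sphere a r) := by
  rintro ⟨u, hu, hexp⟩
  let U : ℝ → ℂ := fun θ => u (circleMap a r θ)
  let V : ℝ → ℂ := fun θ => U 0 + k * (θ * Complex.I)
  have hmem : ∀ θ, circleMap a r θ ∈ Metric.sphere a r := circleMap_mem_sphere a hr.le
  have hU : Continuous U := hu.comp_continuous (continuous_circleMap a r) hmem
  have hUV : U = V := by
    refine Complex.isCoveringMap_exp.eq_of_comp_eq hU (by fun_prop) (funext fun θ => ?_) 0
      (by simp [V])
    simp [U, V, hexp _ (hmem _), Complex.exp_add, Complex.exp_int_mul, circleMap_sub_center,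
      circleMap_zero, mul_zpow]
  have hper : U (2 * Real.pi) = U 0 := congrArg u (by simpa using periodic_circleMap a r 0)
  rw [hUV] at hper
  simp [V, hk, Real.pi_ne_zero] at hper

theorem not_hasLogOn_frontier {U : Set ℂ} (hU : IsOpen U) (hUb : Bornology.IsBounded U) {a : ℂ}
    (ha : a ∈ U) {k : ℤ} (hk : k ≠ 0) {h : ℂ → ℂ} (hh : ContinuousOn h (closure U))
    (h0 : ∀ z ∈ closure U, h z ≠ 0) :
    ¬ HasLogOn (fun z => (z - a) ^ k * h z) (frontier U) := by
  classical
  rintro ⟨u, hu, hexp⟩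
  obtain ⟨G, hG⟩ := ContinuousMap.exists_restrict_eq isClosed_frontier
    ⟨_, continuousOn_iff_continuous_domRestrict.1 hu⟩
  have hGu : ∀ z ∈ frontier U, G z = u z := fun z hz => DFunLike.congr_fun hG ⟨z, hz⟩
  have hne : ∀ z ∉ U, z - a ≠ 0 := fun z hz h => hz (by rwa [sub_eq_zero.1 h])
  let q : ℂ → ℂ := U.piecewise (fun z => Complex.exp (G z) / h z) fun z => (z - a) ^ k
  have hq : Continuous q := by
    refine continuous_piecewise (fun z hz => ?_) (.div (by fun_prop) hh h0) ?_
    · rw [hGu z hz, hexp z hz, mul_div_cancel_right₀ _ (h0 z hz.1)]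
    · rw [hU.isClosed_compl.closure_eq]
      exact .zpow₀ (by fun_prop) k fun z hz => .inl (hne z hz)
  have hq0 : ∀ z, q z ≠ 0 := fun z => by
    by_cases hz : z ∈ U
    · rw [show q z = _ from piecewise_eq_of_mem _ _ _ hz]
      exact div_ne_zero (Complex.exp_ne_zero _) (h0 z (subset_closure hz))
    · rw [show q z = _ from piecewise_eq_of_notMem _ _ _ hz]
      exact zpow_ne_zero _ (hne z hz)
  obtain ⟨r, hr⟩ := hUb.subset_ball a
  refine not_hasLogOn_sphere a (Metric.pos_of_mem_ball (hr ha)) hk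
    (((hasLogOn_univ hq hq0).mono (subset_univ _)).congr fun z hz => ?_)
  exact piecewise_eq_of_notMem _ _ _ fun hzU => (Metric.mem_ball.1 (hr hzU)).ne hz

/-! ### Separation of the plane by compact sets and arcs -/

section Separation

variable {K S : Set ℂ} {a b c : ℂ}

theorem isPreconnected_norm_sub_mem {J : Set ℝ} (hJ : IsPreconnected J) (hJ0 : ∀ r ∈ J, 0 ≤ r) :
    IsPreconnected {z : ℂ | ‖z - c‖ ∈ J} := by
  have himage : {z : ℂ | ‖z - c‖ ∈ J} =
      (fun p : ℝ × ℝ => c + p.1 * Complex.exp (p.2 * Complex.I)) '' (J ×ˢ univ) := by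
    ext z
    constructor
    · exact fun hz => ⟨(‖z - c‖, (z - c).arg), ⟨hz, trivial⟩, by simp⟩
    · rintro ⟨p, ⟨hp, -⟩, rfl⟩
      simpa [Complex.norm_exp_ofReal_mul_I, abs_of_nonneg (hJ0 _ hp)] using hp
  rw [himage]
  exact (hJ.prod isPreconnected_univ).image _ (by fun_prop)

theorem connectedComponentIn_eq_of_not_isBounded (hK : Bornology.IsBounded K)
    (ha : ¬ Bornology.IsBounded (connectedComponentIn Kᶜ a))
    (hb : ¬ Bornology.IsBounded (connectedComponentIn Kᶜ b)) :
    connectedComponentIn Kᶜ a = connectedComponentIn Kᶜ b := by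
  obtain ⟨r, hr, hKr⟩ := hK.exists_pos_norm_le
  have hconn : IsPreconnected {z : ℂ | r < ‖z‖} := by
    simpa using isPreconnected_norm_sub_mem (c := 0) (isPreconnected_Ioi (a := r))
      fun t ht => hr.le.trans (le_of_lt ht)
  have hsub : {z : ℂ | r < ‖z‖} ⊆ Kᶜ := fun z hz h => (hKr z h).not_gt hz
  have hfar : ∀ c, ¬ Bornology.IsBounded (connectedComponentIn Kᶜ c) →
      ∃ z, r < ‖z‖ ∧ z ∈ connectedComponentIn Kᶜ c := by
    intro c hc
    by_contra! h
    exact hc (isBounded_iff_forall_norm_le.2 ⟨r, fun z hz => not_lt.1 fun h' => h z h' hz⟩)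
  obtain ⟨x, hx, hxa⟩ := hfar a ha
  obtain ⟨y, hy, hyb⟩ := hfar b hb
  rw [connectedComponentIn_eq hxa, connectedComponentIn_eq hyb]
  exact connectedComponentIn_eq (hconn.subset_connectedComponentIn hx hsub hy)

theorem frontier_connectedComponentIn_compl_subset (hK : IsClosed K) :
    frontier (connectedComponentIn Kᶜ a) ⊆ K := by
  intro z hz
  by_contra hzK
  have hopen (x : ℂ) : IsOpen (connectedComponentIn Kᶜ x) := hK.isOpen_compl.connectedComponentIn
  obtain ⟨y, hyz, hya⟩ := mem_closure_iff.1 hz.1 _ (hopen z) (mem_connectedComponentIn hzK)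
  refine hz.2 ?_
  rw [(hopen a).interior_eq, connectedComponentIn_eq hya, ← connectedComponentIn_eq hyz]
  exact mem_connectedComponentIn hzK

theorem not_isBounded_of_hasLogOn_prod {ι : Type*} [Fintype ι] (hK : IsClosed K) {a : ι → ℂ}
    (ha : ∀ i, a i ∉ K) (hinj : Function.Injective fun i => connectedComponentIn Kᶜ (a i))
    {n : ι → ℤ} (hlog : HasLogOn (fun z => ∏ i, (z - a i) ^ n i) K) {i : ι} (hi : n i ≠ 0) :
    ¬ Bornology.IsBounded (connectedComponentIn Kᶜ (a i)) := by
  classical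
  intro hb
  have hfr := frontier_connectedComponentIn_compl_subset (a := a i) hK
  have hne : ∀ j ≠ i, ∀ z ∈ closure (connectedComponentIn Kᶜ (a i)), z - a j ≠ 0 := by
    intro j hj z hz h0
    rw [sub_eq_zero.1 h0] at hz
    by_cases hin : a j ∈ connectedComponentIn Kᶜ (a i)
    · exact hj (hinj (connectedComponentIn_eq hin).symm)
    · exact ha j (hfr ⟨hz, fun h => hin (interior_subset h)⟩)
  refine not_hasLogOn_frontier hK.isOpen_compl.connectedComponentIn hb
    (mem_connectedComponentIn (ha i)) hi (h := fun z => ∏ j ∈ Finset.univ.erase i, (z - a j) ^ n j)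
    ?_ ?_ ((hlog.mono hfr).congr fun z _ => ?_)
  · exact continuousOn_finsetProd _ fun j hj => .zpow₀ (by fun_prop) _ fun z hz =>
      .inl (hne j (Finset.ne_of_mem_erase hj) z hz)
  · exact fun z hz => Finset.prod_ne_zero_iff.2 fun j hj =>
      zpow_ne_zero _ (hne j (Finset.ne_of_mem_erase hj) z hz)
  · exact (Finset.mul_prod_erase Finset.univ (fun j => (z - a j) ^ n j) (Finset.mem_univ i)).symm

open Topology Filter in
theorem hasLogOn_sub_div_sub_of_isPreconnected (hS : IsPreconnected S) (hK : IsClosed K)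
    (hSK : S ⊆ Kᶜ) (ha : a ∈ S) (hb : b ∈ S) : HasLogOn (fun z => (z - a) / (z - b)) K := by
  have hne : ∀ x ∈ S, ∀ z ∈ K, z - x ≠ 0 := fun x hx z hz h =>
    hSK hx (by rwa [← sub_eq_zero.1 h])
  refine hS.induction₂ (fun a b => HasLogOn (fun z => (z - a) / (z - b)) K) ?_ ?_ ?_ ha hb
  · intro x hx
    obtain ⟨ε, hε, hball⟩ := Metric.isOpen_iff.1 hK.isOpen_compl x (hSK hx)
    filter_upwards [eventually_mem_nhdsWithin,
      nhdsWithin_le_nhds (Metric.ball_mem_nhds x (half_pos hε))] with y hyS hy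
    have hlt : ∀ z ∈ K, ‖(y - x) / (z - y)‖ < 1 := by
      intro z hz
      have hzx : ε ≤ dist z x := not_lt.1 fun h => hball h hz
      rw [norm_div, div_lt_one (norm_pos_iff.2 (hne y hyS z hz)), ← dist_eq_norm, ← dist_eq_norm]
      linarith [dist_triangle z y x, Metric.mem_ball.1 hy]
    have hslit : ∀ z ∈ K, (z - x) / (z - y) ∈ Complex.slitPlane := fun z hz => by
      have heq : (z - x) / (z - y) = 1 + (y - x) / (z - y) := by
        have := hne y hyS z hz
        field_simp
        ring
      exact heq ▸ Complex.mem_slitPlane_of_norm_lt_one (hlt z hz)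
    exact ⟨fun z => Complex.log ((z - x) / (z - y)),
      .clog (.div (by fun_prop) (by fun_prop) (hne y hyS)) hslit,
      fun z hz => Complex.exp_log (Complex.slitPlane_ne_zero (hslit z hz))⟩
  · exact fun x y _ _ hy _ hxy hyw => (hxy.mul hyw).congr fun z hz =>
      div_mul_div_cancel₀ (hne y hy z hz)
  · exact fun x y _ _ hxy => (hxy.zpow (-1)).congr fun z _ => by simp

end Separation

namespace IsArc

variable {K S e : Set ℂ} {u v w : ℂ}

theorem isCompact (h : IsArc u v e) : IsCompact e := by
  obtain ⟨γ, -, rfl⟩ := h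
  exact isCompact_range γ.continuous

theorem isPreconnected (h : IsArc u v e) : IsPreconnected e := by
  obtain ⟨γ, -, rfl⟩ := h
  exact isPreconnected_range γ.continuous

theorem symm (h : IsArc u v e) : IsArc v u e := by
  obtain ⟨γ, hγ, rfl⟩ := h
  exact ⟨γ.symm, hγ.comp unitInterval.symm_bijective.injective, γ.symm_range⟩

theorem ne (h : IsArc u v e) : u ≠ v := by
  obtain ⟨γ, hγ, rfl⟩ := h
  exact fun huv => zero_ne_one (hγ (by rw [γ.source, γ.target, huv]))

theorem source_mem (h : IsArc u v e) : u ∈ e := by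
  obtain ⟨γ, -, rfl⟩ := h
  exact ⟨0, γ.source⟩

theorem target_mem (h : IsArc u v e) : v ∈ e :=
  h.symm.source_mem

theorem hasLogOn (h : IsArc u v e) {f : ℂ → ℂ} (hf : ContinuousOn f e) (h0 : ∀ z ∈ e, f z ≠ 0) :
    HasLogOn f e := by
  obtain ⟨γ, hγ, rfl⟩ := h
  have := (convex_Icc (0 : ℝ) 1).locallyPathConnectedSpace
  have := (convex_Icc (0 : ℝ) 1).contractibleSpace (nonempty_Icc.2 zero_le_one)
  exact hasLogOn_range (γ.continuous.isClosedEmbedding hγ).isEmbedding hf h0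

theorem hasLogOn_sub_div_sub (he : IsArc u v e) {a b : ℂ} (ha : a ∉ e) (hb : b ∉ e) :
    HasLogOn (fun z => (z - a) / (z - b)) e := by
  have hne : ∀ x ∉ e, ∀ z ∈ e, z - x ≠ 0 := fun x hx z hz h => hx (by rwa [← sub_eq_zero.1 h])
  exact he.hasLogOn (.div (by fun_prop) (by fun_prop) (hne b hb)) fun z hz =>
    div_ne_zero (hne a ha z hz) (hne b hb z hz)

/-- A product of powers of the quotients `(z - a i) / (z - a 2)` has a logarithm on `K ∪ e`; if the
components of the three points were different, two of them would have to be unbounded. -/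
theorem not_injective_connectedComponentIn (he : IsArc u v e) (hK : IsCompact K)
    (hKe : K ∩ e = {u, v}) (hS : IsPreconnected S) (hSK : S ⊆ Kᶜ) {a : Fin 3 → ℂ}
    (ha : ∀ i, a i ∈ S \ e) :
    ¬ Function.Injective fun i => connectedComponentIn (K ∪ e)ᶜ (a i) := by
  intro hinj
  have hlogK (i : Fin 3) : HasLogOn (fun z => (z - a i) / (z - a 2)) K :=
    hasLogOn_sub_div_sub_of_isPreconnected hS hK.isClosed hSK (ha i).1 (ha 2).1
  have hloge (i : Fin 3) : HasLogOn (fun z => (z - a i) / (z - a 2)) e :=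
    he.hasLogOn_sub_div_sub (ha i).2 (ha 2).2
  have hnot (i : Fin 3) : a i ∉ K ∪ e := fun h => h.elim (hSK (ha i).1) (ha i).2
  obtain ⟨p, q, hpq, hlog⟩ := HasLogOn.exists_zpow_mul_zpow_union hK.isClosed
    he.isCompact.isClosed hKe (hlogK 0) (hloge 0) (hlogK 1) (hloge 1)
  let n : Fin 3 → ℤ := ![p, q, -(p + q)]
  have hprod : HasLogOn (fun z => ∏ i, (z - a i) ^ n i) (K ∪ e) := hlog.congr fun z hz => by
    have hz2 : z - a 2 ≠ 0 := fun h => hnot 2 (by rwa [← sub_eq_zero.1 h])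
    simp only [n, Fin.prod_univ_three, Matrix.cons_val, Pi.mul_apply, Pi.pow_apply, div_zpow,
      zpow_neg, zpow_add₀ hz2]
    ring
  have hunique {i j : Fin 3} (hi : n i ≠ 0) (hj : n j ≠ 0) : i = j :=
    have hunbdd {i : Fin 3} := not_isBounded_of_hasLogOn_prod (i := i)
      (hK.isClosed.union he.isCompact.isClosed) hnot hinj hprod
    hinj (connectedComponentIn_eq_of_not_isBounded (hK.union he.isCompact).isBounded
      (hunbdd hi) (hunbdd hj))
  have h01 : ¬ (p ≠ 0 ∧ q ≠ 0) := fun h =>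
    absurd (hunique (i := 0) (j := 1) h.1 h.2) (by decide)
  have h02 : ¬ (p ≠ 0 ∧ -(p + q) ≠ 0) := fun h =>
    absurd (hunique (i := 0) (j := 2) h.1 h.2) (by decide)
  have h12 : ¬ (q ≠ 0 ∧ -(p + q) ≠ 0) := fun h =>
    absurd (hunique (i := 1) (j := 2) h.1 h.2) (by decide)
  omega

theorem encard_image_connectedComponentIn_le_two (he : IsArc u v e) (hK : IsCompact K)
    (hKe : K ∩ e = {u, v}) (hS : IsPreconnected S) (hSK : S ⊆ Kᶜ) :
    (connectedComponentIn (K ∪ e)ᶜ '' (S \ e)).encard ≤ 2 := by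
  by_contra! h
  obtain ⟨T, hTS, hT⟩ := exists_subset_encard_eq (Order.add_one_le_of_lt h)
  obtain ⟨x, y, z, hxy, hxz, hyz, rfl⟩ := encard_eq_three.1 (hT.trans (by norm_num))
  simp only [insert_subset_iff, singleton_subset_iff] at hTS
  obtain ⟨⟨a, ha, rfl⟩, ⟨b, hb, rfl⟩, ⟨c, hc, rfl⟩⟩ := hTS
  refine he.not_injective_connectedComponentIn hK hKe hS hSK (a := ![a, b, c])
    (Fin.forall_fin_succ.2 ⟨ha, Fin.forall_fin_two.2 ⟨hb, hc⟩⟩) ?_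
  intro i j hij
  fin_cases i <;> fin_cases j <;> simp_all [eq_comm]

theorem image_Icc {γ : Path u v} (hγ : Function.Injective γ) {s t : unitInterval} (hst : s < t) :
    IsArc (γ s) (γ t) (γ '' Icc s t) := by
  refine ⟨γ.subpath s t, hγ.comp fun x y hxy => Subtype.ext ?_, γ.range_subpath_of_le s t hst.le⟩
  have h := congrArg Subtype.val hxy
  simp only [Icc.coe_convexComb] at h
  have hne : (t : ℝ) - s ≠ 0 := (sub_pos.2 (show (s : ℝ) < t from hst)).ne'
  apply mul_left_cancel₀ hne
  linear_combination h

theorem exists_split (h : IsArc u v e) (hw : w ∈ e) (hwu : w ≠ u) (hwv : w ≠ v) :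
    ∃ e₁ e₂, IsArc u w e₁ ∧ IsArc w v e₂ ∧ e₁ ∪ e₂ = e ∧ e₁ ∩ e₂ = {w} := by
  obtain ⟨γ, hγ, rfl⟩ := h
  obtain ⟨t, rfl⟩ := hw
  have ht0 : 0 < t := bot_lt_iff_ne_bot.2 fun h => hwu ((congrArg γ h).trans γ.source)
  have ht1 : t < 1 := lt_top_iff_ne_top.2 fun h => hwv ((congrArg γ h).trans γ.target)
  refine ⟨γ '' Icc 0 t, γ '' Icc t 1, ?_, ?_, ?_, ?_⟩
  · simpa using image_Icc hγ ht0
  · simpa using image_Icc hγ ht1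
  · rw [← image_union, Icc_union_Icc_eq_Icc ht0.le ht1.le, ← image_univ]
    exact congrArg _ (eq_univ_of_forall fun x => ⟨bot_le, le_top⟩)
  · rw [← image_inter hγ, Icc_inter_Icc, sup_of_le_right ht0.le, inf_of_le_left ht1.le, Icc_self,
      image_singleton]

/-- An inner point `w` divides the arc into two closed sets, which would disconnect a punctured disc
around `w` contained in the arc. -/
theorem interior_eq_empty (h : IsArc u v e) : interior e = ∅ := by
  by_contra! hint
  obtain ⟨w, hwe, hwuv⟩ := ((finite_singleton v).insert u).countable.dense_compl ℝ
    |>.inter_open_nonempty _ isOpen_interior hint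
  simp only [mem_compl_iff, mem_insert_iff, mem_singleton_iff, not_or] at hwuv
  obtain ⟨e₁, e₂, h₁, h₂, hunion, hinter⟩ := h.exists_split (interior_subset hwe) hwuv.1 hwuv.2
  obtain ⟨r, hr, hball⟩ := Metric.mem_nhds_iff.1 (mem_interior_iff_mem_nhds.1 hwe)
  let D : Set ℂ := {z | ‖z - w‖ ∈ Ioo 0 r}
  have hD : IsPreconnected D := isPreconnected_norm_sub_mem isPreconnected_Ioo fun t ht => ht.1.le
  have hDe : D ⊆ e₁ ∪ e₂ := fun z hz => hunion ▸ hball (mem_ball_iff_norm.2 hz.2)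
  have hmeet : ∀ e', IsPreconnected e' → e'.Nontrivial → w ∈ e' → (D ∩ e').Nonempty := by
    intro e' hc hnt hwe
    obtain ⟨y, ⟨hyr, hye⟩, hyw⟩ :=
      accPt_iff_nhds.1 (hc.preperfect_of_nontrivial hnt w hwe) _ (Metric.ball_mem_nhds w hr)
    exact ⟨y, ⟨norm_sub_pos_iff.2 hyw, mem_ball_iff_norm.1 hyr⟩, hye⟩
  obtain ⟨z, hzD, hz⟩ := isPreconnected_closed_iff.1 hD e₁ e₂ h₁.isCompact.isClosed
    h₂.isCompact.isClosed hDe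
    (hmeet e₁ h₁.isPreconnected ⟨u, h₁.source_mem, w, h₁.target_mem, h₁.ne⟩ h₁.target_mem)
    (hmeet e₂ h₂.isPreconnected ⟨w, h₂.source_mem, v, h₂.target_mem, h₂.ne⟩ h₂.source_mem)
  rw [hinter, mem_singleton_iff] at hz
  exact norm_sub_pos_iff.1 hzD.1 hz

end IsArc

/-! ### Shannon's edge coloring theorem -/

section EdgeColoring

variable {E V C : Type*} {ends : E → Sym2 V} {s : Set E} {c : E → C} {α β γ : C} {e₀ e₁ : E}
  {u v w x y z : V}

theorem finite_of_connected_of_finite_edgeSet {G : SimpleGraph V} (hG : G.Connected)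
    (hE : G.edgeSet.Finite) : Finite V := by
  rcases subsingleton_or_nontrivial V with _ | _
  · infer_instance
  have hends (e : Sym2 V) : {v | v ∈ e}.Finite := by
    induction e with
    | _ a b => exact (Set.toFinite {a, b}).subset fun v hv => Sym2.mem_iff.1 hv
  refine Set.finite_univ_iff.1 ((hE.biUnion fun e _ => hends e).subset fun v hv => ?_)
  rw [← hG.preconnected.support_eq_univ] at hv
  obtain ⟨w, hw⟩ := hv
  exact mem_biUnion (show s(v, w) ∈ G.edgeSet from hw) (Sym2.mem_mk_left v w)

/-- The degrees sum to at least `2 * (n - 1)`, where `n` is the number of vertices. -/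
theorem encard_setOf_ncard_neighborSet_le_one {G : SimpleGraph V} (hG : G.Connected)
    (hE : G.edgeSet.Finite) (hdeg : ∀ v, (G.neighborSet v).ncard ≤ 2) :
    {v | (G.neighborSet v).ncard ≤ 1}.encard ≤ 2 := by
  classical
  have := finite_of_connected_of_finite_edgeSet hG hE
  have := Fintype.ofFinite V
  have hdegree (v : V) : (G.neighborSet v).ncard = G.degree v := by
    rw [← G.card_neighborSet_eq_degree, ← Nat.card_eq_fintype_card, Nat.card_coe_set_eq]
  have hvert := hG.card_vert_le_card_edgeSet_add_one
  have hsum := G.sum_degrees_eq_twice_card_edges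
  simp only [← hdegree] at hsum
  rw [Nat.card_eq_fintype_card, Nat.card_eq_fintype_card, ← SimpleGraph.edgeFinset_card] at hvert
  have hle : ∑ v, ((G.neighborSet v).ncard + if (G.neighborSet v).ncard ≤ 1 then 1 else 0) ≤
      ∑ _v : V, 2 := Finset.sum_le_sum fun v _ => by have := hdeg v; split_ifs <;> omega
  rw [Finset.sum_add_distrib, ← Finset.card_filter, Finset.sum_const, Finset.card_univ,
    smul_eq_mul, hsum] at hle
  rw [← Finset.coe_filter_univ, encard_coe_eq_coe_finsetCard]
  norm_cast
  omega

theorem encard_setOf_reachable_and_encard_neighborSet_le_one {G : SimpleGraph V}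
    (hE : G.edgeSet.Finite) (hdeg : ∀ v, (G.neighborSet v).encard ≤ 2) (x : V) :
    {v | G.Reachable x v ∧ (G.neighborSet v).encard ≤ 1}.encard ≤ 2 := by
  set K := G.connectedComponentMk x
  have hE' : K.toSimpleGraph.edgeSet.Finite :=
    have := hE.to_subtype
    have := Finite.of_injective _
      (SimpleGraph.Hom.mapEdgeSet.injective K.toSimpleGraph_hom Subtype.val_injective)
    toFinite _
  have hle (v : K) {n : ℕ} (hn : (G.neighborSet v).encard ≤ n) :
      (K.toSimpleGraph.neighborSet v).ncard ≤ n := by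
    refine (encard_le_coe_iff_finite_ncard_le.1 (le_trans ?_ hn)).2
    exact encard_le_encard_of_injOn (f := Subtype.val) (fun u hu => hu) Subtype.val_injective.injOn
  have hK := encard_setOf_ncard_neighborSet_le_one K.connected_toSimpleGraph hE' fun v =>
    hle v (hdeg v)
  rw [← Subtype.val_injective.encard_image] at hK
  refine (encard_le_encard ?_).trans hK
  rintro v ⟨hxv, hv⟩
  exact ⟨⟨v, SimpleGraph.ConnectedComponent.sound hxv.symm⟩, hle _ hv, rfl⟩

/-- The set of edges in `s` at the vertex `v` of the multigraph whose edges have the ends given by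
`ends`. An edge with `ends e = s(v, v)` is a half-edge at `v`: it is counted once. -/
def edgesAt (ends : E → Sym2 V) (s : Set E) (v : V) : Set E :=
  {e ∈ s | v ∈ ends e}

theorem edgesAt_mono {t : Set E} (hst : s ⊆ t) : edgesAt ends s v ⊆ edgesAt ends t v :=
  fun _ he => ⟨hst he.1, he.2⟩

/-- The coloring `c` is a proper edge coloring of the part of a multigraph with edge set `s`. -/
def IsProperOn (ends : E → Sym2 V) (s : Set E) (c : E → C) : Prop :=
  ∀ v, InjOn c (edgesAt ends s v)

/-- The set of colors that do not occur on the edges in `s` at the vertex `v`. -/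
def missingColors (ends : E → Sym2 V) (s : Set E) (c : E → C) (v : V) : Set C :=
  (c '' edgesAt ends s v)ᶜ

theorem mem_missingColors :
    γ ∈ missingColors ends s c v ↔ ∀ e ∈ s, v ∈ ends e → c e ≠ γ := by
  simp only [missingColors, edgesAt, mem_compl_iff, mem_image, mem_ofPred_eq, not_exists, not_and,
    and_imp, ne_eq]

theorem card_le_ncard_missingColors_add [Finite E] [Finite C] :
    Nat.card C ≤ (missingColors ends s c v).ncard + (edgesAt ends s v).ncard := by
  rw [← ncard_add_ncard_compl (c '' edgesAt ends s v), add_comm]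
  exact Nat.add_le_add_left (ncard_image_le (toFinite _)) _

theorem ncard_edgesAt_lt [Finite E] (he : e₀ ∉ s) (hv : v ∈ ends e₀) :
    (edgesAt ends s v).ncard < (edgesAt ends univ v).ncard :=
  ncard_lt_ncard ((ssubset_iff_of_subset (edgesAt_mono (subset_univ s))).2
    ⟨e₀, ⟨trivial, hv⟩, fun h => he h.1⟩)

namespace IsProperOn

theorem mono {t : Set E} (hc : IsProperOn ends s c) (hts : t ⊆ s) : IsProperOn ends t c :=
  fun v => (hc v).mono (edgesAt_mono hts)

theorem update_insert [DecidableEq E] (hc : IsProperOn ends s c) (he₀ : e₀ ∉ s)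
    (hγ : ∀ v ∈ ends e₀, γ ∈ missingColors ends s c v) :
    IsProperOn ends (insert e₀ s) (Function.update c e₀ γ) := by
  have hne : ∀ e ∈ s, e ≠ e₀ := fun e he h => he₀ (h ▸ he)
  rintro v e ⟨rfl | he, hv⟩ e' ⟨rfl | he', hv'⟩ heq
  · rfl
  · rw [Function.update_self, Function.update_of_ne (hne e' he')] at heq
    exact absurd heq.symm (mem_missingColors.1 (hγ v hv) e' he' hv')
  · rw [Function.update_self, Function.update_of_ne (hne e he)] at heq
    exact absurd heq (mem_missingColors.1 (hγ v hv') e he hv)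
  · rw [Function.update_of_ne (hne e he), Function.update_of_ne (hne e' he')] at heq
    exact hc v ⟨he, hv⟩ ⟨he', hv'⟩ heq

/-- The edge `e₁` is recolored, and its former color is given to `e₀`. -/
theorem exists_insert_of_recolor (hc : IsProperOn ends s c) (he₀ : e₀ ∉ s)
    (hends₀ : ends e₀ = s(x, y)) (he₁ : e₁ ∈ s) (hends₁ : ends e₁ = s(y, z))
    (hx : c e₁ ∈ missingColors ends s c x) (hy : γ ∈ missingColors ends s c y)
    (hz : γ ∈ missingColors ends s c z) : ∃ c' : E → C, IsProperOn ends (insert e₀ s) c' := by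
  classical
  have hy₁ : y ∈ ends e₁ := hends₁ ▸ Sym2.mem_mk_left y z
  have hc' : IsProperOn ends s (Function.update c e₁ γ) := by
    rw [← insert_sdiff_self_of_mem he₁]
    refine (hc.mono sdiff_subset).update_insert (fun h => h.2 rfl) fun v hv => ?_
    rw [hends₁, Sym2.mem_iff] at hv
    refine mem_missingColors.2 fun e he => ?_
    rcases hv with rfl | rfl
    · exact mem_missingColors.1 hy e he.1
    · exact mem_missingColors.1 hz e he.1
  refine ⟨_, hc'.update_insert he₀ (γ := c e₁) fun v hv => mem_missingColors.2 fun e he hev => ?_⟩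
  rw [hends₀, Sym2.mem_iff] at hv
  by_cases hee : e = e₁
  · rw [hee, Function.update_self]
    exact (mem_missingColors.1 hy e₁ he₁ hy₁).symm
  · rw [Function.update_of_ne hee]
    rcases hv with rfl | rfl
    · exact mem_missingColors.1 hx e he hev
    · exact fun h => hee (hc v ⟨he, hev⟩ ⟨he₁, hy₁⟩ h)

end IsProperOn

/-- The simple graph formed by the edges in `s` colored `α` or `β`; its connected components are the
Kempe chains of these two colors. -/
def kempeGraph (ends : E → Sym2 V) (s : Set E) (c : E → C) (α β : C) : SimpleGraph V :=
  SimpleGraph.fromEdgeSet (ends '' {e ∈ s | c e = α ∨ c e = β})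

open Classical in
/-- The coloring obtained from `c` by interchanging `α` and `β` along the Kempe chain of `x`. Edges
of other colors at this chain are not affected. -/
noncomputable def kempeSwap (ends : E → Sym2 V) (s : Set E) (c : E → C) (α β : C) (x : V) : E → C :=
  fun e => if ∃ v ∈ ends e, (kempeGraph ends s c α β).Reachable x v then Equiv.swap α β (c e)
    else c e

section Kempe

theorem reachable_kempeGraph {e : E} (he : e ∈ s) (hce : c e = α ∨ c e = β) (hu : u ∈ ends e)
    (hv : v ∈ ends e) : (kempeGraph ends s c α β).Reachable u v := by
  rcases eq_or_ne u v with rfl | huv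
  · rfl
  · refine SimpleGraph.Adj.reachable ((SimpleGraph.fromEdgeSet_adj _).2 ⟨⟨e, ⟨he, hce⟩, ?_⟩, huv⟩)
    exact (Sym2.mem_and_mem_iff huv).1 ⟨hu, hv⟩

open Classical in
theorem kempeSwap_of_reachable {e : E} (hv : v ∈ ends e)
    (hxv : (kempeGraph ends s c α β).Reachable x v) :
    kempeSwap ends s c α β x e = Equiv.swap α β (c e) :=
  if_pos ⟨v, hv, hxv⟩

theorem kempeSwap_of_not_reachable {e : E} (he : e ∈ s) (hv : v ∈ ends e)
    (hxv : ¬ (kempeGraph ends s c α β).Reachable x v) : kempeSwap ends s c α β x e = c e := by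
  classical
  by_cases h : ∃ w ∈ ends e, (kempeGraph ends s c α β).Reachable x w
  · obtain ⟨w, hw, hxw⟩ := h
    have hce : ¬ (c e = α ∨ c e = β) := fun hce =>
      hxv (hxw.trans (reachable_kempeGraph he hce hw hv))
    rw [kempeSwap_of_reachable hw hxw]
    exact Equiv.swap_apply_of_ne_of_ne (fun h => hce (.inl h)) fun h => hce (.inr h)
  · exact if_neg h

theorem IsProperOn.kempeSwap (hc : IsProperOn ends s c) (α β : C) (x : V) :
    IsProperOn ends s (kempeSwap ends s c α β x) := by
  classical
  rintro v e ⟨he, hv⟩ e' ⟨he', hv'⟩ heq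
  refine hc v ⟨he, hv⟩ ⟨he', hv'⟩ ?_
  by_cases hxv : (kempeGraph ends s c α β).Reachable x v
  · rw [kempeSwap_of_reachable hv hxv, kempeSwap_of_reachable hv' hxv] at heq
    exact (Equiv.swap α β).injective heq
  · rwa [kempeSwap_of_not_reachable he hv hxv, kempeSwap_of_not_reachable he' hv' hxv] at heq

open Classical in
theorem missingColors_kempeSwap_of_reachable (hxv : (kempeGraph ends s c α β).Reachable x v) :
    missingColors ends s (kempeSwap ends s c α β x) v =
      Equiv.swap α β '' missingColors ends s c v := by
  rw [missingColors, missingColors, image_compl_eq (Equiv.bijective _), image_image]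
  exact congrArg _ (image_congr fun e he => kempeSwap_of_reachable he.2 hxv)

theorem missingColors_kempeSwap_of_not_reachable
    (hxv : ¬ (kempeGraph ends s c α β).Reachable x v) :
    missingColors ends s (kempeSwap ends s c α β x) v = missingColors ends s c v :=
  congrArg _ (image_congr fun _ he => kempeSwap_of_not_reachable he.1 he.2 hxv)

theorem IsProperOn.encard_neighborSet_kempeGraph_le (hc : IsProperOn ends s c) (v : V) :
    ((kempeGraph ends s c α β).neighborSet v).encard ≤
      ({α, β} \ missingColors ends s c v : Set C).encard := by
  have hex : ∀ u : (kempeGraph ends s c α β).neighborSet v,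
      ∃ e ∈ s, (c e = α ∨ c e = β) ∧ ends e = s(v, u) := fun u => by
    obtain ⟨e, ⟨he, hce⟩, heu⟩ := ((SimpleGraph.fromEdgeSet_adj _).1 u.2).1
    exact ⟨e, he, hce, heu⟩
  choose edge hedge hcolor hends using hex
  have hmem (u) : edge u ∈ edgesAt ends s v := ⟨hedge u, hends u ▸ Sym2.mem_mk_left _ _⟩
  have hinj : Function.Injective (c ∘ edge) := fun u u' h => by
    have := hends u' ▸ hends u ▸ congrArg ends (hc v (hmem u) (hmem u') h)
    exact Subtype.ext (Sym2.congr_right.1 this)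
  rw [← ENat.card_coe_set_eq, ← encard_univ, ← hinj.encard_image]
  refine encard_le_encard ?_
  rintro _ ⟨u, -, rfl⟩
  exact ⟨hcolor u, fun h => h ⟨_, hmem u, rfl⟩⟩

/-- A Kempe chain is a path or a cycle. -/
theorem IsProperOn.encard_ends_kempeChain_le_two [Finite E] (hc : IsProperOn ends s c) (x : V) :
    {v | (kempeGraph ends s c α β).Reachable x v ∧
      (α ∈ missingColors ends s c v ∨ β ∈ missingColors ends s c v)}.encard ≤ 2 := by
  have hE : (kempeGraph ends s c α β).edgeSet.Finite := by
    rw [kempeGraph, SimpleGraph.edgeSet_fromEdgeSet]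
    exact (toFinite _).subset sdiff_subset
  refine (encard_le_encard ?_).trans (encard_setOf_reachable_and_encard_neighborSet_le_one hE
    (fun v => ((hc.encard_neighborSet_kempeGraph_le v).trans (encard_le_encard sdiff_subset)).trans
      ((encard_insert_le _ _).trans_eq (by rw [encard_singleton, one_add_one_eq_two]))) x)
  rintro v ⟨hxv, hv⟩
  refine ⟨hxv, (hc.encard_neighborSet_kempeGraph_le v).trans (encard_le_one_iff.2 ?_)⟩
  rintro γ δ ⟨rfl | rfl, hγ⟩ ⟨rfl | rfl, hδ⟩ <;> tauto

end Kempe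

section Extension

variable (hc : IsProperOn ends s c) (he₀ : e₀ ∉ s)
  (hno : ¬ ∃ c' : E → C, IsProperOn ends (insert e₀ s) c')

include hc he₀ hno

theorem IsProperOn.disjoint_missingColors_of_ends_eq (hends₀ : ends e₀ = s(x, y)) :
    Disjoint (missingColors ends s c x) (missingColors ends s c y) := by
  classical
  refine disjoint_left.2 fun γ hx hy => hno ⟨_, hc.update_insert he₀ (γ := γ) fun v hv => ?_⟩
  rw [hends₀, Sym2.mem_iff] at hv
  rcases hv with rfl | rfl <;> assumption

/-- A color `γ` missing at both `x` and `z` and a color `δ` missing at `y` have a Kempe chain that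
avoids one of `x`, `y`, `z`; interchanging them along the chain of `z` or of `y` makes the extension
to `e₀` possible. -/
theorem IsProperOn.disjoint_missingColors_of_missing [Finite E] (hends₀ : ends e₀ = s(x, y))
    (he₁ : e₁ ∈ s) (hends₁ : ends e₁ = s(y, z)) (hx : c e₁ ∈ missingColors ends s c x)
    (hy : (missingColors ends s c y).Nonempty) :
    Disjoint (missingColors ends s c x) (missingColors ends s c z) := by
  classical
  obtain ⟨δ, hδy⟩ := hy
  refine disjoint_left.2 fun γ hγx hγz => ?_
  have hdisj {c' : E → C} (hc' : IsProperOn ends s c') :=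
    disjoint_left.1 (hc'.disjoint_missingColors_of_ends_eq he₀ hno hends₀)
  have hy₁ : y ∈ ends e₁ := hends₁ ▸ Sym2.mem_mk_left y z
  have hz₁ : z ∈ ends e₁ := hends₁ ▸ Sym2.mem_mk_right y z
  have hxy : x ≠ y := fun h => hdisj hc hγx (h ▸ hγx)
  have hyz : y ≠ z := fun h => hdisj hc hγx (h ▸ hγz)
  have hxz : x ≠ z := fun h => mem_missingColors.1 hx e₁ he₁ (h ▸ hz₁) rfl
  by_cases hyx : (kempeGraph ends s c γ δ).Reachable y x
  · have hzy : ¬ (kempeGraph ends s c γ δ).Reachable z y := fun hzy => by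
      have hle := hc.encard_ends_kempeChain_le_two (α := γ) (β := δ) y
      have hthree : ({x, y, z} : Set V).encard = 3 :=
        encard_eq_three.2 ⟨x, y, z, hxy, hxz, hyz, rfl⟩
      refine absurd ((hthree.symm.trans_le (encard_le_encard ?_)).trans hle) (by decide)
      rintro v (rfl | rfl | rfl)
      · exact ⟨hyx, .inl hγx⟩
      · exact ⟨.rfl, .inr hδy⟩
      · exact ⟨hzy.symm, .inl hγz⟩
    have hzx : ¬ (kempeGraph ends s c γ δ).Reachable z x := fun hzx => hzy (hzx.trans hyx.symm)
    refine hno ((hc.kempeSwap γ δ z).exists_insert_of_recolor he₀ hends₀ he₁ hends₁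
      (γ := δ) ?_ ?_ ?_)
    · rwa [missingColors_kempeSwap_of_not_reachable hzx, kempeSwap_of_not_reachable he₁ hy₁ hzy]
    · rwa [missingColors_kempeSwap_of_not_reachable hzy]
    · rw [missingColors_kempeSwap_of_reachable .rfl]
      exact ⟨γ, hγz, Equiv.swap_apply_left γ δ⟩
  · refine hdisj (hc.kempeSwap γ δ y) (a := γ) ?_ ?_
    · rwa [missingColors_kempeSwap_of_not_reachable hyx]
    · rw [missingColors_kempeSwap_of_reachable .rfl]
      exact ⟨δ, hδy, Equiv.swap_apply_right γ δ⟩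

end Extension

/-- Otherwise the sets of colors missing at three vertices would be pairwise disjoint, and they are
too large for this. -/
theorem IsProperOn.exists_insert [Finite E] [Finite C] {D : ℕ} (hC : 3 * D ≤ 2 * Nat.card C + 1)
    (hD : ∀ v, (edgesAt ends univ v).ncard ≤ D) (hc : IsProperOn ends s c) (he₀ : e₀ ∉ s) :
    ∃ c' : E → C, IsProperOn ends (insert e₀ s) c' := by
  by_contra hno
  obtain ⟨x, y, hends₀⟩ : ∃ x y, ends e₀ = s(x, y) := Sym2.exists.1 ⟨ends e₀, rfl⟩
  have hlt (v : V) (hv : v ∈ ends e₀) : (edgesAt ends s v).ncard < D :=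
    (ncard_edgesAt_lt he₀ hv).trans_le (hD v)
  have hltx := hlt x (hends₀ ▸ Sym2.mem_mk_left x y)
  have hlty := hlt y (hends₀ ▸ Sym2.mem_mk_right x y)
  have hmissing (v : V) := card_le_ncard_missingColors_add (ends := ends) (s := s) (c := c) (v := v)
  have hnonempty {v : V} (hv : (edgesAt ends s v).ncard < D) :
      (missingColors ends s c v).Nonempty :=
    nonempty_of_ncard_ne_zero (by have := hmissing v; omega)
  have hxy := hc.disjoint_missingColors_of_ends_eq he₀ hno hends₀
  obtain ⟨_, hβ⟩ := hnonempty hltx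
  obtain ⟨e₁, ⟨he₁, hy₁⟩, rfl⟩ := not_not.1 (disjoint_left.1 hxy hβ)
  obtain ⟨z, hends₁⟩ := hy₁
  have hxz := hc.disjoint_missingColors_of_missing he₀ hno hends₀ he₁ hends₁ hβ (hnonempty hlty)
  have hyz : Disjoint (missingColors ends s c y) (missingColors ends s c z) :=
    disjoint_left.2 fun γ hγy hγz =>
      hno (hc.exists_insert_of_recolor he₀ hends₀ he₁ hends₁ hβ hγy hγz)
  have hz : (edgesAt ends s z).ncard ≤ D :=
    (ncard_le_ncard (edgesAt_mono (subset_univ s))).trans (hD z)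
  have hunion := ncard_le_card (missingColors ends s c x ∪ missingColors ends s c y ∪
    missingColors ends s c z)
  rw [ncard_union_eq (hxz.union_left hyz), ncard_union_eq hxy] at hunion
  have := hmissing x
  have := hmissing y
  have := hmissing z
  omega

theorem exists_isProperOn_univ [Finite E] (ends : E → Sym2 V) {D : ℕ}
    (hD : ∀ v, (edgesAt ends univ v).ncard ≤ D) :
    ∃ c : E → Fin (3 * D / 2), IsProperOn ends univ c := by
  have hempty : ∃ c : E → Fin (3 * D / 2), IsProperOn ends ∅ c := by
    suffices hpos : Nonempty E → 0 < D by
      rcases isEmpty_or_nonempty E with _ | hE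
      · exact ⟨isEmptyElim, fun v e he => absurd he.1 (notMem_empty e)⟩
      · have := hpos hE
        exact ⟨fun _ => ⟨0, by omega⟩, fun v e he => absurd he.1 (notMem_empty e)⟩
    rintro ⟨e⟩
    have he : e ∈ edgesAt ends univ (ends e).out.1 := ⟨trivial, Sym2.out_fst_mem (ends e)⟩
    exact (Nat.pos_of_ne_zero (ncard_ne_zero_of_mem he)).trans_le (hD _)
  induction (univ : Set E), toFinite (univ : Set E) using Set.Finite.induction_on with
  | empty => exact hempty
  | insert he _ ih =>
    obtain ⟨c, hc⟩ := ih
    exact hc.exists_insert (by rw [Nat.card_fin]; omega) hD he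

end EdgeColoring

namespace PlaneGraph

variable {G R : PlaneGraph} {e f U : Set ℂ} {u v w z : ℂ}

/-! ### Faces of a plane graph -/

theorem isCompact_of_mem_edges (he : e ∈ R.edges) : IsCompact e := by
  obtain ⟨u, v, h, -⟩ := R.edge_isArc e he
  exact h.isCompact

theorem isCompact_support (R : PlaneGraph) : IsCompact R.support :=
  R.verts_finite.isCompact.union
    (R.edges_finite.isCompact_sUnion fun _ he => isCompact_of_mem_edges he)

theorem eq_connectedComponentIn_of_mem_faces (hf : f ∈ R.faces) (hz : z ∈ f) :
    f = connectedComponentIn R.supportᶜ z := by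
  obtain ⟨x, -, rfl⟩ := hf
  exact connectedComponentIn_eq hz

theorem subset_compl_support_of_mem_faces (hf : f ∈ R.faces) : f ⊆ R.supportᶜ := by
  obtain ⟨x, -, rfl⟩ := hf
  exact connectedComponentIn_subset _ _

theorem isOpen_of_mem_faces (hf : f ∈ R.faces) : IsOpen f := by
  obtain ⟨x, -, rfl⟩ := hf
  exact R.isCompact_support.isClosed.isOpen_compl.connectedComponentIn

theorem faces_nonempty (R : PlaneGraph) : R.faces.Nonempty := by
  obtain ⟨x, hx⟩ := nonempty_compl.2 R.isCompact_support.ne_univ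
  exact ⟨_, x, hx, rfl⟩

theorem mem_faces_of_frontier_subset_support (hU : IsOpen U) (hconn : IsPreconnected U)
    (hne : U.Nonempty) (hsub : U ⊆ R.supportᶜ) (hfr : frontier U ⊆ R.support) : U ∈ R.faces := by
  obtain ⟨x, hx⟩ := hne
  refine ⟨x, hsub hx, (hconn.subset_connectedComponentIn hx hsub).antisymm ?_⟩
  refine isPreconnected_connectedComponentIn.subset_of_closure_inter_subset hU
    ⟨x, mem_connectedComponentIn (hsub hx), hx⟩ fun z hz => by_contra fun hzU => ?_
  exact connectedComponentIn_subset _ _ hz.2 (hfr ⟨hz.1, fun h => hzU (interior_subset h)⟩)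

theorem mem_frontier_iff_mem_closure_of_mem_faces (hf : f ∈ R.faces) (hw : w ∈ R.support) :
    w ∈ frontier f ↔ w ∈ closure f := by
  rw [(isOpen_of_mem_faces hf).frontier_eq]
  exact and_iff_left fun h => subset_compl_support_of_mem_faces hf h hw

/-- The set of faces whose boundary contains the point `w`. -/
def incidentFaces (R : PlaneGraph) (w : ℂ) : Set (Set ℂ) :=
  {f ∈ R.faces | w ∈ frontier f}

theorem exists_isArc_union_eq_support (hw : w ∈ R.support) (hwV : w ∉ R.verts) :
    ∃ (e K : Set ℂ) (u v : ℂ), IsArc u v e ∧ IsCompact K ∧ K ∩ e = {u, v} ∧ K ∪ e = R.support ∧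
      w ∉ K := by
  obtain ⟨e, he, hwe⟩ := hw.resolve_left hwV
  obtain ⟨u, v, harc, huv⟩ := R.edge_isArc e he
  have hKe : (R.verts ∪ ⋃₀ (R.edges \ {e})) ∩ e = {u, v} := by
    rw [← huv]
    refine subset_antisymm ?_ fun z hz => ⟨.inl hz.2, hz.1⟩
    rintro z ⟨hz | ⟨e', ⟨he', hne⟩, hz⟩, hze⟩
    · exact ⟨hze, hz⟩
    · exact ⟨hze, R.edge_inter e' he' e he hne ⟨hz, hze⟩⟩
  refine ⟨e, R.verts ∪ ⋃₀ (R.edges \ {e}), u, v, harc, ?_, hKe, ?_, fun hwK => ?_⟩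
  · exact R.verts_finite.isCompact.union
      ((R.edges_finite.subset sdiff_subset).isCompact_sUnion fun _ h => isCompact_of_mem_edges h.1)
  · rw [support, union_assoc, union_comm _ e, ← sUnion_insert e, insert_sdiff_self_of_mem he]
  · exact hwV (huv.superset (hKe.subset ⟨hwK, hwe⟩)).2

theorem encard_incidentFaces_le_two (hw : w ∈ R.support) (hwV : w ∉ R.verts) :
    (R.incidentFaces w).encard ≤ 2 := by
  obtain ⟨e, K, u, v, he, hK, hKe, hsupp, hwK⟩ := exists_isArc_union_eq_support hw hwV
  obtain ⟨r, hr, hball⟩ := Metric.isOpen_iff.1 hK.isClosed.isOpen_compl w hwK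
  refine (encard_le_encard ?_).trans
    (he.encard_image_connectedComponentIn_le_two hK hKe (convex_ball w r).isPreconnected hball)
  rintro f ⟨hf, hwf⟩
  obtain ⟨z, hzr, hzf⟩ := mem_closure_iff_nhds.1 hwf.1 _ (Metric.ball_mem_nhds w hr)
  have hze : z ∉ e := fun hze =>
    subset_compl_support_of_mem_faces hf hzf (hsupp.subset (.inr hze))
  rw [hsupp]
  exact ⟨z, ⟨hzr, hze⟩, (eq_connectedComponentIn_of_mem_faces hf hzf).symm⟩

theorem incidentFaces_nonempty (hw : w ∈ R.support) (hwV : w ∉ R.verts) :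
    (R.incidentFaces w).Nonempty := by
  obtain ⟨e, K, u, v, he, hK, hKe, hsupp, hwK⟩ := exists_isArc_union_eq_support hw hwV
  obtain ⟨r, hr, hball⟩ := Metric.isOpen_iff.1 hK.isClosed.isOpen_compl w hwK
  let T := connectedComponentIn R.supportᶜ '' (Metric.ball w r \ e)
  have hT : T.Finite := by
    have hle := he.encard_image_connectedComponentIn_le_two hK hKe
      (convex_ball w r).isPreconnected hball
    rw [hsupp] at hle
    exact Set.finite_of_encard_le_coe (k := 2) hle
  have hcompl : ∀ z ∈ Metric.ball w r \ e, z ∈ R.supportᶜ := fun z hz => by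
    rw [← hsupp]
    exact fun h => h.elim (hball hz.1) hz.2
  have hclosure : w ∈ closure (⋃ f ∈ T, f) := by
    have hdense : Dense eᶜ := interior_eq_empty_iff_dense_compl.1 he.interior_eq_empty
    refine closure_mono ?_ (hdense.open_subset_closure_inter Metric.isOpen_ball
      (Metric.mem_ball_self hr))
    exact fun z hz => mem_biUnion (mem_image_of_mem _ hz) (mem_connectedComponentIn (hcompl z hz))
  rw [hT.closure_biUnion] at hclosure
  obtain ⟨_, ⟨z, hz, rfl⟩, hwz⟩ := mem_iUnion₂.1 hclosure
  have hface : connectedComponentIn R.supportᶜ z ∈ R.faces := ⟨z, hcompl z hz, rfl⟩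
  exact ⟨_, hface, (mem_frontier_iff_mem_closure_of_mem_faces hface hw).2 hwz⟩

/-! ### Cyclic colorings of subdivisions -/

theorem IsSubdivision.support_eq (h : G.IsSubdivision R) : G.support = R.support := by
  induction h with
  | refl => rfl
  | tail _ hstep ih => rw [hstep.support_eq, ih]

theorem IsSubdivision.verts_subset (h : G.IsSubdivision R) : R.verts ⊆ G.verts := by
  induction h with
  | refl => rfl
  | tail _ hstep ih =>
    obtain ⟨_, -, _, _, _, _, _, -, -, -, -, -, -, -, hV, -⟩ := hstep
    exact ih.trans (hV ▸ subset_insert _ _)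

theorem IsCyclicColoring.cyclicChromaticNumber_le {C : Type} [Finite C] {c : G.verts → C}
    (hc : G.IsCyclicColoring c) : G.cyclicChromaticNumber ≤ Nat.card C :=
  Nat.sInf_le ⟨fun v => Finite.equivFin C (c v), fun f hf u v hu hv huv h =>
    hc f hf u v hu hv huv ((Finite.equivFin C).injective h)⟩

theorem isCyclicColoring_of_injective {C : Type} {c : G.verts → C} (hc : Function.Injective c) :
    G.IsCyclicColoring c :=
  fun _ _ _ _ _ _ huv h => huv (hc h)

theorem exists_isCyclicColoring (G : PlaneGraph) :
    ∃ c : G.verts → Fin G.cyclicChromaticNumber, G.IsCyclicColoring c :=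
  have := G.verts_finite.to_subtype
  Nat.sInf_mem (s := {k : ℕ | ∃ c : G.verts → Fin k, G.IsCyclicColoring c})
    ⟨Nat.card G.verts, Finite.equivFin G.verts, isCyclicColoring_of_injective (Equiv.injective _)⟩

theorem faceDegree_sub_faceDegree (h : R.verts ⊆ G.verts) (f : Set ℂ) :
    (G.faceDegree f : ℤ) - R.faceDegree f = ((G.verts \ R.verts) ∩ frontier f).ncard := by
  have hdiff : (G.verts \ R.verts) ∩ frontier f = G.faceVerts f \ R.faceVerts f := by
    ext z
    simp only [faceVerts, mem_inter_iff, mem_sdiff]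
    tauto
  have hcard := ncard_sdiff_add_ncard_of_subset (inter_subset_inter_left (frontier f) h)
    (G.verts_finite.inter_of_left _)
  rw [hdiff, faceDegree, faceDegree, faceVerts, faceVerts]
  omega

theorem IsSubdivision.exists_isGreatest (h : G.IsSubdivision R) :
    ∃ M : ℕ, IsGreatest (G.degreeDifferences R) M := by
  obtain ⟨M, hM⟩ : ∃ M, IsGreatest (G.degreeDifferences R) M := by
    refine BddAbove.exists_isGreatest_of_nonempty ⟨G.verts.ncard, ?_⟩
      (by obtain ⟨f, hf⟩ := G.faces_nonempty; exact ⟨_, f, hf, rfl⟩)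
    rintro _ ⟨f, -, rfl⟩
    have : G.faceDegree f ≤ G.verts.ncard := ncard_le_ncard inter_subset_left G.verts_finite
    omega
  have hM0 : 0 ≤ M := by
    obtain ⟨f, -, rfl⟩ := hM.1
    rw [faceDegree_sub_faceDegree h.verts_subset]
    exact Int.natCast_nonneg _
  lift M to ℕ using hM0
  exact ⟨M, hM⟩

theorem exists_sym2_mem_iff {X : Type*} {s : Set X} (hs : s.Nonempty) (hs2 : s.encard ≤ 2) :
    ∃ p : Sym2 X, ∀ x, x ∈ p ↔ x ∈ s := by
  obtain ⟨x, hx⟩ := hs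
  rcases hs2.eq_or_lt with h | h
  · obtain ⟨y, z, -, rfl⟩ := encard_eq_two.1 h
    exact ⟨s(y, z), fun _ => Sym2.mem_iff⟩
  · rw [← one_add_one_eq_two] at h
    have hsub := encard_le_one_iff_subsingleton.1 (Order.le_of_lt_add_one h)
    exact ⟨s(x, x), fun y => by simp [hsub.eq_singleton_of_mem hx]⟩

/-- The new vertices are the edges of a multigraph whose vertices are the faces, each joining the
faces incident with it. -/
theorem IsSubdivision.exists_coloring_sdiff (h : G.IsSubdivision R) {M : ℕ}
    (hM : ∀ d ∈ G.degreeDifferences R, d ≤ M) :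
    ∃ c : ↥(G.verts \ R.verts) → Fin (3 * M / 2),
      ∀ f ∈ R.faces, InjOn c (Subtype.val ⁻¹' frontier f) := by
  have := (G.verts_finite.subset (sdiff_subset (t := R.verts))).to_subtype
  have hends (w : ↥(G.verts \ R.verts)) : ∃ p : Sym2 (Set ℂ), ∀ f, f ∈ p ↔ f ∈ R.incidentFaces w :=
    have hw : (w : ℂ) ∈ R.support := h.support_eq ▸ .inl w.2.1
    exists_sym2_mem_iff (incidentFaces_nonempty hw w.2.2) (encard_incidentFaces_le_two hw w.2.2)
  choose ends hends using hends
  have hedges {f : Set ℂ} (hf : f ∈ R.faces) :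
      edgesAt ends univ f = Subtype.val ⁻¹' frontier f := by
    ext w
    simp [edgesAt, hends, incidentFaces, hf]
  have hD (f : Set ℂ) : (edgesAt ends univ f).ncard ≤ M := by
    by_cases hf : f ∈ R.faces
    · rw [hedges hf]
      have hle := hM _ ⟨f, h.faces_eq ▸ hf, rfl⟩
      rw [faceDegree_sub_faceDegree h.verts_subset, Nat.cast_le] at hle
      rwa [← ncard_image_of_injective _ Subtype.val_injective, Subtype.image_preimage_coe]
    · have hempty : edgesAt ends univ f = ∅ :=
        eq_empty_of_forall_notMem fun w hw => hf ((hends w f).1 hw.2).1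
      simp [hempty]
  obtain ⟨c, hc⟩ := exists_isProperOn_univ ends hD
  exact ⟨c, fun f hf => hedges hf ▸ hc f⟩

theorem IsSubdivision.cyclicChromaticNumber_le (h : G.IsSubdivision R) {M : ℕ}
    (hM : ∀ d ∈ G.degreeDifferences R, d ≤ M) :
    G.cyclicChromaticNumber ≤ 3 * M / 2 + R.cyclicChromaticNumber := by
  classical
  obtain ⟨c, hc⟩ := h.exists_coloring_sdiff hM
  obtain ⟨d, hd⟩ := R.exists_isCyclicColoring
  let col : G.verts → Fin (3 * M / 2) ⊕ Fin R.cyclicChromaticNumber := fun v =>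
    if hv : (v : ℂ) ∈ R.verts then .inr (d ⟨v, hv⟩) else .inl (c ⟨v, v.2, hv⟩)
  have hcol : G.IsCyclicColoring col := by
    intro f hf u v hu hv huv heq
    have hf' : f ∈ R.faces := h.faces_eq ▸ hf
    by_cases hu' : (u : ℂ) ∈ R.verts <;> by_cases hv' : (v : ℂ) ∈ R.verts <;>
      simp only [col, hu', hv', dite_true, dite_false, reduceCtorEq, Sum.inr.injEq,
        Sum.inl.injEq] at heq
    · exact hd f hf' ⟨u, hu'⟩ ⟨v, hv'⟩ ⟨hu', hu.2⟩ ⟨hv', hv.2⟩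
        (fun h => huv (Subtype.ext (Subtype.mk.inj h))) heq
    · exact huv (Subtype.ext (Subtype.mk.inj (hc f hf' hu.2 hv.2 heq)))
  simpa using hcol.cyclicChromaticNumber_le

theorem floor_three_halves_mul (M : ℕ) : ⌊(3 / 2 : ℝ) * ((M : ℤ) : ℝ)⌋ = ((3 * M / 2 : ℕ) : ℤ) := by
  have h : (3 / 2 : ℝ) * ((M : ℤ) : ℝ) = ((3 * M : ℤ) : ℝ) / (2 : ℕ) := by
    push_cast
    ring
  rw [h, Int.floor_div_natCast, Int.floor_intCast]
  push_cast
  rfl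

/-! ### Subdividing at prescribed points -/

theorem inter_insert_eq_pair {e' : Set ℂ} (huv : e ∩ R.verts = {u, v}) (he' : e' ⊆ e)
    (hue' : u ∈ e') (hve' : v ∉ e') (hwe' : w ∈ e') : e' ∩ insert w R.verts = {u, w} := by
  have hinter : e' ∩ R.verts = {u} := by
    rw [← inter_eq_left.2 he', inter_assoc, huv]
    ext z
    simp only [mem_inter_iff, mem_insert_iff, mem_singleton_iff]
    constructor
    · rintro ⟨hz, rfl | rfl⟩
      · rfl
      · exact absurd hz hve'
    · rintro rfl
      exact ⟨hue', .inl rfl⟩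
  rw [inter_insert_of_mem hwe', hinter, pair_comm]

theorem pairwise_inter_subset_insert {e₁ e₂ : Set ℂ} (he : e ∈ R.edges) (hunion : e₁ ∪ e₂ = e)
    (hinter : e₁ ∩ e₂ = {w}) :
    (R.edges \ {e} ∪ {e₁, e₂}).Pairwise fun e' e'' => e' ∩ e'' ⊆ insert w R.verts := by
  have : Std.Symm fun e' e'' : Set ℂ => e' ∩ e'' ⊆ insert w R.verts :=
    ⟨fun _ _ h => by rwa [inter_comm]⟩
  rw [pairwise_union_of_symm, pairwise_pair_of_symm]
  refine ⟨fun e' he' e'' he'' hne => ?_, fun _ => ?_, fun e' he' e'' he'' _ => ?_⟩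
  · exact (R.edge_inter e' he'.1 e'' he''.1 hne).trans (subset_insert _ _)
  · exact hinter.subset.trans (singleton_subset_iff.2 (mem_insert _ _))
  · have hsub : e'' ⊆ e := by
      rcases he'' with rfl | rfl
      exacts [hunion ▸ subset_union_left, hunion ▸ subset_union_right]
    exact (inter_subset_inter_right _ hsub).trans
      ((R.edge_inter e' he'.1 e he he'.2).trans (subset_insert _ _))

theorem exists_subdivisionStep (hw : w ∈ R.support) (hwV : w ∉ R.verts) :
    ∃ G : PlaneGraph, SubdivisionStep R G ∧ G.verts = insert w R.verts := by
  obtain ⟨e, he, hwe⟩ := hw.resolve_left hwV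
  obtain ⟨u, v, harc, huv⟩ := R.edge_isArc e he
  have hu : u ∈ R.verts := (huv.superset (.inl rfl)).2
  have hv : v ∈ R.verts := (huv.superset (.inr rfl)).2
  have hwu : w ≠ u := fun h => hwV (h ▸ hu)
  have hwv : w ≠ v := fun h => hwV (h ▸ hv)
  obtain ⟨e₁, e₂, h₁, h₂, hun, hin⟩ := harc.exists_split hwe hwu hwv
  have hsub₁ : e₁ ⊆ e := hun ▸ subset_union_left
  have hsub₂ : e₂ ⊆ e := hun ▸ subset_union_right
  have hv₁ : v ∉ e₁ := fun h => hwv (hin.subset ⟨h, h₂.target_mem⟩).symm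
  have hu₂ : u ∉ e₂ := fun h => hwu (hin.subset ⟨h₁.source_mem, h⟩).symm
  have harcs : ∀ e' ∈ R.edges \ {e} ∪ {e₁, e₂}, ∃ x y, IsArc x y e' ∧
      e' ∩ insert w R.verts = {x, y} := by
    rintro e' (he' | rfl | rfl)
    · obtain ⟨x, y, hxy, hxy'⟩ := R.edge_isArc e' he'.1
      have hwe' : w ∉ e' := fun h =>
        hwV (R.edge_inter e' he'.1 e he he'.2 ⟨h, hwe⟩)
      exact ⟨x, y, hxy, by rw [inter_insert_of_notMem hwe', hxy']⟩
    · exact ⟨u, w, h₁, inter_insert_eq_pair huv hsub₁ h₁.source_mem hv₁ h₁.target_mem⟩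
    · exact ⟨v, w, h₂.symm, inter_insert_eq_pair (huv.trans (pair_comm u v)) hsub₂
        h₂.target_mem hu₂ h₂.source_mem⟩
  exact ⟨⟨insert w R.verts, R.edges \ {e} ∪ {e₁, e₂}, R.verts_finite.insert w,
    (R.edges_finite.subset sdiff_subset).union (by simp), harcs,
    fun _ he' _ he'' hne => pairwise_inter_subset_insert he hun hin he' he'' hne⟩,
    ⟨e, he, u, v, w, e₁, e₂, huv, hwe, hwV, h₁, h₂, hun, hin, rfl, rfl⟩, rfl⟩

theorem exists_isSubdivision (R : PlaneGraph) {W : Set ℂ} (hW : W.Finite) (hWR : W ⊆ R.support) :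
    ∃ G : PlaneGraph, G.IsSubdivision R ∧ G.verts = R.verts ∪ W := by
  induction W, hW using Set.Finite.induction_on with
  | empty => exact ⟨R, .refl, (union_empty _).symm⟩
  | @insert w W _ _ ih =>
    obtain ⟨G, hG, hV⟩ := ih ((subset_insert _ _).trans hWR)
    by_cases hw : w ∈ G.verts
    · refine ⟨G, hG, ?_⟩
      rw [union_insert, ← hV, insert_eq_of_mem hw]
    · obtain ⟨G', hstep, hV'⟩ := exists_subdivisionStep
        (hG.support_eq.symm ▸ hWR (mem_insert w W)) hw
      exact ⟨G', hG.tail hstep, by rw [hV', hV, union_insert]⟩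

theorem cyclicChromaticNumber_eq_ncard
    (h : ∀ u ∈ G.verts, ∀ v ∈ G.verts, ∃ f ∈ G.faces, u ∈ frontier f ∧ v ∈ frontier f) :
    G.cyclicChromaticNumber = G.verts.ncard := by
  have := G.verts_finite.to_subtype
  rw [← Nat.card_coe_set_eq]
  refine le_antisymm (isCyclicColoring_of_injective Function.injective_id).cyclicChromaticNumber_le
    ?_
  obtain ⟨c, hc⟩ := G.exists_isCyclicColoring
  have hinj : Function.Injective c := fun u v huv => by_contra fun hne => by
    obtain ⟨f, hf, hu, hv⟩ := h u u.2 v v.2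
    exact hc f hf u v ⟨u.2, hu⟩ ⟨v.2, hv⟩ hne huv
  simpa using Nat.card_le_card_of_injective c hinj

theorem isThreeConnected_of_adjGraph_eq_top (hG : 4 ≤ G.verts.ncard) (htop : G.adjGraph = ⊤) :
    G.IsThreeConnected := by
  refine ⟨hG, fun X hX => ?_⟩
  have := G.verts_finite.to_subtype
  have hne : (Xᶜ).Nonempty := by
    rw [nonempty_compl]
    rintro rfl
    rw [ncard_univ, Nat.card_coe_set_eq] at hX
    omega
  have := hne.to_subtype
  rw [htop, SimpleGraph.induce_top]
  exact SimpleGraph.connected_top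

end PlaneGraph

/-! ### The tight example -/

theorem isArc_segment {p q : ℂ} (h : p ≠ q) : IsArc p q (segment ℝ p q) := by
  refine ⟨⟨⟨fun t => AffineMap.lineMap p q (t : ℝ), by fun_prop⟩, by simp, by simp⟩, ?_, ?_⟩
  · exact fun s t hst => Subtype.ext (AffineMap.lineMap_injective ℝ h hst)
  · rw [segment_eq_image_lineMap, image_eq_range]
    rfl

namespace Tetrahedron

variable (b : AffineBasis (Fin 3) ℝ ℂ) {i j k : Fin 3} {s t : ℝ} {z w : ℂ} {P : Set ℝ}

theorem exists_forall_ne_eq_or_eq : ∀ i j : Fin 3, i ≠ j →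
    ∃ k, k ≠ i ∧ k ≠ j ∧ ∀ l, l ≠ k → l = i ∨ l = j := by
  decide

theorem eq_of_forall_ne_coord_eq (i : Fin 3) (h : ∀ j ≠ i, b.coord j z = b.coord j w) : z = w := by
  refine b.ext_elem fun j => ?_
  obtain rfl | hj := eq_or_ne j i
  · have hsum := (b.sum_coord_apply_eq_one z).trans (b.sum_coord_apply_eq_one w).symm
    rw [Fintype.sum_eq_add_sum_compl j, Fintype.sum_eq_add_sum_compl j (b.coord · w),
      Finset.sum_congr rfl fun l hl => h l (by simpa using hl)] at hsum
    exact add_right_cancel hsum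
  · exact h j hj

/-- The centroid of the triangle with corners `b`, the inner vertex of the drawing of `K₄`. -/
noncomputable def center : ℂ :=
  Finset.univ.centroid ℝ b

/-- The point dividing the segment from the center to the `i`-th corner in the ratio
`t : 1 - t`. -/
noncomputable def spokePoint (i : Fin 3) (t : ℝ) : ℂ :=
  AffineMap.lineMap (center b) (b i) t

/-- The edge of `K₄` from the center to the `i`-th corner. -/
def spoke (i : Fin 3) : Set ℂ :=
  segment ℝ (center b) (b i)

/-- The edge of `K₄` opposite to the `i`-th corner. -/
def rim (i : Fin 3) : Set ℂ :=
  segment ℝ (b (i + 1)) (b (i + 2))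

/-- The vertices of the drawing of `K₄`. -/
def vertexSet : Set ℂ :=
  insert (center b) (range b)

/-- The open triangle spanned by the center and the corners other than the `k`-th one. -/
def triangle (k : Fin 3) : Set ℂ :=
  {z | 0 < b.coord k z ∧ ∀ j ≠ k, b.coord k z < b.coord j z}

theorem coord_center (i : Fin 3) : b.coord i (center b) = 1 / 3 := by
  rw [center, b.coord_apply_centroid (Finset.mem_univ i), Finset.card_univ, Fintype.card_fin]
  norm_num

theorem coord_spokePoint (i j : Fin 3) (t : ℝ) :
    b.coord j (spokePoint b i t) = (1 - t) / 3 + if j = i then t else 0 := by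
  rw [spokePoint, AffineMap.apply_lineMap, coord_center, b.coord_apply, AffineMap.lineMap_apply]
  split_ifs <;> simp <;> ring

theorem coord_spokePoint_self (i : Fin 3) (t : ℝ) :
    b.coord i (spokePoint b i t) = (1 - t) / 3 + t := by
  rw [coord_spokePoint, if_pos rfl]

variable {b} in
theorem coord_spokePoint_of_ne (h : j ≠ i) (t : ℝ) :
    b.coord j (spokePoint b i t) = (1 - t) / 3 := by
  rw [coord_spokePoint, if_neg h, add_zero]

theorem spokePoint_zero (i : Fin 3) : spokePoint b i 0 = center b :=
  AffineMap.lineMap_apply_zero _ _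

theorem spokePoint_one (i : Fin 3) : spokePoint b i 1 = b i :=
  AffineMap.lineMap_apply_one _ _

variable {b} in
theorem mem_spoke_iff_exists : z ∈ spoke b i ↔ ∃ t ∈ Icc (0 : ℝ) 1, spokePoint b i t = z := by
  rw [spoke, segment_eq_image_lineMap]
  rfl

variable {b} in
theorem spokePoint_mem_spoke (i : Fin 3) (ht : t ∈ Icc (0 : ℝ) 1) : spokePoint b i t ∈ spoke b i :=
  mem_spoke_iff_exists.2 ⟨t, ht, rfl⟩

variable {b} in
theorem eq_and_eq_of_spokePoint_eq (hs : 0 < s) (ht : 0 < t)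
    (h : spokePoint b i s = spokePoint b j t) : i = j ∧ s = t := by
  have hi := congrArg (b.coord i) h
  have hj := congrArg (b.coord j) h
  simp only [coord_spokePoint, if_true] at hi hj
  obtain rfl | hij := eq_or_ne i j
  · rw [if_pos rfl] at hi
    exact ⟨rfl, by linarith⟩
  · rw [if_neg hij] at hi
    rw [if_neg hij.symm] at hj
    linarith

variable {b} in
theorem mem_spoke_iff :
    z ∈ spoke b i ↔ ∃ r, 0 ≤ r ∧ (∀ j ≠ i, b.coord j z = r) ∧ r ≤ b.coord i z := by
  have hcard : (Finset.card {i}ᶜ : ℝ) = 2 := by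
    rw [Finset.card_compl, Finset.card_singleton, Fintype.card_fin]
    norm_num
  rw [mem_spoke_iff_exists]
  constructor
  · rintro ⟨t, ht, rfl⟩
    refine ⟨(1 - t) / 3, by linarith [ht.2], fun j hj => coord_spokePoint_of_ne hj t, ?_⟩
    linarith [coord_spokePoint_self b i t, ht.1]
  · rintro ⟨r, hr, hj, hri⟩
    have hsum := b.sum_coord_apply_eq_one z
    rw [Fintype.sum_eq_add_sum_compl i,
      Finset.sum_congr rfl fun l hl => hj l (by simpa using hl), Finset.sum_const, nsmul_eq_mul,
      hcard] at hsum
    refine ⟨1 - 3 * r, ⟨by linarith, by linarith⟩, eq_of_forall_ne_coord_eq b i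
      fun l hl => ?_⟩
    rw [coord_spokePoint_of_ne hl, hj l hl]
    ring

theorem coord_sum (i : Fin 3) : b.coord i z + b.coord (i + 1) z + b.coord (i + 2) z = 1 := by
  rw [← b.sum_coord_apply_eq_one z, Fin.sum_univ_three]
  fin_cases i <;> simp <;> ring

variable {b} in
theorem mem_rim_iff : z ∈ rim b i ↔ b.coord i z = 0 ∧ ∀ j, 0 ≤ b.coord j z := by
  have hcoord (j : Fin 3) (t : ℝ) : b.coord j (AffineMap.lineMap (b (i + 1)) (b (i + 2)) t) =
      (1 - t) * (if j = i + 1 then 1 else 0) + t * (if j = i + 2 then 1 else 0) := by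
    rw [AffineMap.apply_lineMap, b.coord_apply, b.coord_apply, AffineMap.lineMap_apply_module]
    rfl
  rw [rim, segment_eq_image_lineMap]
  constructor
  · rintro ⟨t, ⟨ht0, ht1⟩, rfl⟩
    refine ⟨by simp [hcoord], fun j => ?_⟩
    rw [hcoord]
    split_ifs <;> linarith
  · rintro ⟨hi, hj⟩
    refine ⟨b.coord (i + 2) z, ⟨hj _, ?_⟩, eq_of_forall_ne_coord_eq b (i + 1) ?_⟩
    · linarith [coord_sum b (z := z) i, hj (i + 1)]
    · have hindex : ∀ i l : Fin 3, l ≠ i + 1 → l = i ∨ l = i + 2 := by decide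
      intro l hl
      obtain rfl | rfl := hindex i l hl <;> simp [hcoord, hi]

theorem spoke_inter_vertexSet (i : Fin 3) : spoke b i ∩ vertexSet b = {center b, b i} := by
  refine subset_antisymm ?_ (pair_subset ⟨left_mem_segment _ _ _, mem_insert _ _⟩
    ⟨right_mem_segment _ _ _, .inr ⟨i, rfl⟩⟩)
  rintro _ ⟨hz, rfl | ⟨j, rfl⟩⟩
  · exact .inl rfl
  · obtain rfl | hj := eq_or_ne j i
    · exact .inr rfl
    · obtain ⟨r, -, hr, hri⟩ := mem_spoke_iff.1 hz
      have hj1 := hr j hj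
      have hi0 := b.coord_apply_ne hj.symm
      rw [b.coord_apply_eq] at hj1
      linarith

theorem rim_inter_vertexSet (i : Fin 3) : rim b i ∩ vertexSet b = {b (i + 1), b (i + 2)} := by
  refine subset_antisymm ?_ (pair_subset ⟨left_mem_segment _ _ _, .inr ⟨_, rfl⟩⟩
    ⟨right_mem_segment _ _ _, .inr ⟨_, rfl⟩⟩)
  rintro _ ⟨hz, rfl | ⟨j, rfl⟩⟩
  · have := (mem_rim_iff.1 hz).1
    rw [coord_center] at this
    norm_num at this
  · have hji : j ≠ i := by
      rintro rfl
      simpa using (mem_rim_iff.1 hz).1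
    have hindex : ∀ i j : Fin 3, j ≠ i → j = i + 1 ∨ j = i + 2 := by decide
    obtain rfl | rfl := hindex i j hji
    exacts [.inl rfl, .inr rfl]

theorem spoke_inter_spoke_subset (h : i ≠ j) : spoke b i ∩ spoke b j ⊆ vertexSet b := by
  rintro z ⟨hi, hj⟩
  obtain ⟨s, hs, rfl⟩ := mem_spoke_iff_exists.1 hi
  obtain ⟨t, ht, hst⟩ := mem_spoke_iff_exists.1 hj
  obtain rfl | hs0 := hs.1.eq_or_lt
  · exact .inl (spokePoint_zero b i)
  obtain rfl | ht0 := ht.1.eq_or_lt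
  · exact .inl (hst.symm.trans (spokePoint_zero b j))
  exact absurd (eq_and_eq_of_spokePoint_eq hs0 ht0 hst.symm).1 h

theorem spoke_inter_rim_subset : spoke b i ∩ rim b j ⊆ vertexSet b := by
  rintro z ⟨hi, hj⟩
  obtain ⟨r, hr0, hr, hri⟩ := mem_spoke_iff.1 hi
  obtain ⟨hj, -⟩ := mem_rim_iff.1 hj
  have hr0 : r = 0 := by
    obtain rfl | hji := eq_or_ne j i
    · linarith
    · rw [← hr j hji, hj]
  suffices z = b i from this ▸ .inr ⟨i, rfl⟩
  exact eq_of_forall_ne_coord_eq b i fun l hl => by rw [hr l hl, hr0, b.coord_apply_ne hl]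

theorem rim_inter_rim_subset (h : i ≠ j) : rim b i ∩ rim b j ⊆ vertexSet b := by
  rintro z ⟨hi, hj⟩
  obtain ⟨k, -, -, hk⟩ := exists_forall_ne_eq_or_eq i j h
  suffices z = b k from this ▸ .inr ⟨k, rfl⟩
  refine eq_of_forall_ne_coord_eq b k fun l hl => ?_
  rw [b.coord_apply_ne hl]
  obtain rfl | rfl := hk l hl
  exacts [(mem_rim_iff.1 hi).1, (mem_rim_iff.1 hj).1]

/-- The edges of the drawing of `K₄`. -/
def edgeSet : Set (Set ℂ) :=
  range (spoke b) ∪ range (rim b)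

theorem center_ne_corner (i : Fin 3) : center b ≠ b i := by
  intro h
  have hcoord := coord_center b i
  rw [h, b.coord_apply_eq] at hcoord
  norm_num at hcoord

variable {b} in
theorem exists_eq_segment {e : Set ℂ} (he : e ∈ edgeSet b) :
    ∃ p q, p ≠ q ∧ e = segment ℝ p q ∧ e ∩ vertexSet b = {p, q} := by
  obtain ⟨i, rfl⟩ | ⟨i, rfl⟩ := he
  · exact ⟨_, _, center_ne_corner b i, rfl, spoke_inter_vertexSet b i⟩
  · have hindex : i + 1 ≠ i + 2 := by decide +revert
    exact ⟨_, _, b.ind.injective.ne hindex, rfl, rim_inter_vertexSet b i⟩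

variable {b} in
theorem inter_subset_vertexSet {e e' : Set ℂ} (he : e ∈ edgeSet b) (he' : e' ∈ edgeSet b)
    (h : e ≠ e') : e ∩ e' ⊆ vertexSet b := by
  obtain ⟨i, rfl⟩ | ⟨i, rfl⟩ := he <;> obtain ⟨j, rfl⟩ | ⟨j, rfl⟩ := he'
  · exact spoke_inter_spoke_subset b (ne_of_apply_ne _ h)
  · exact spoke_inter_rim_subset b
  · exact (inter_comm _ _).trans_subset (spoke_inter_rim_subset b)
  · exact rim_inter_rim_subset b (ne_of_apply_ne _ h)

/-- The straight-line drawing of `K₄` whose outer vertices are the corners of a triangle and whose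
inner vertex is its centroid. -/
noncomputable def planeGraph : PlaneGraph where
  verts := vertexSet b
  edges := edgeSet b
  verts_finite := (finite_range b).insert _
  edges_finite := (finite_range _).union (finite_range _)
  edge_isArc e he := by
    obtain ⟨p, q, hpq, rfl, hV⟩ := exists_eq_segment he
    exact ⟨p, q, isArc_segment hpq, hV⟩
  edge_inter _ he _ he' h := inter_subset_vertexSet he he' h

theorem isSimple_planeGraph : (planeGraph b).IsSimple := by
  intro e he e' he' h
  obtain ⟨p, q, -, rfl, hV⟩ := exists_eq_segment he
  obtain ⟨p', q', -, rfl, hV'⟩ := exists_eq_segment he'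
  obtain ⟨rfl, rfl⟩ | ⟨rfl, rfl⟩ := pair_eq_pair_iff.1 (hV.symm.trans (h.trans hV'))
  · rfl
  · exact segment_symm ℝ _ _

theorem ncard_vertexSet : (vertexSet b).ncard = 4 := by
  have hcenter : center b ∉ range b := fun ⟨i, hi⟩ => center_ne_corner b i hi.symm
  rw [vertexSet, ncard_insert_of_notMem hcenter (finite_range b), ← image_univ,
    ncard_image_of_injective _ b.ind.injective, ncard_univ, Nat.card_eq_fintype_card,
    Fintype.card_fin]

theorem adjGraph_planeGraph : (planeGraph b).adjGraph = ⊤ := by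
  ext ⟨u, hu⟩ ⟨v, hv⟩
  refine ⟨fun h => h.1, fun h => ⟨h, ?_⟩⟩
  have hspoke (i : Fin 3) : ∃ e ∈ edgeSet b, e ∩ vertexSet b = {center b, b i} :=
    ⟨_, .inl ⟨i, rfl⟩, spoke_inter_vertexSet b i⟩
  obtain rfl | ⟨i, rfl⟩ := hu <;> obtain rfl | ⟨j, rfl⟩ := hv
  · exact absurd rfl h
  · exact hspoke j
  · obtain ⟨e, he, hV⟩ := hspoke i
    exact ⟨e, he, hV.trans (pair_comm _ _)⟩
  · have hij : i ≠ j := by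
      rintro rfl
      exact h rfl
    have hindex : ∀ i j : Fin 3, i ≠ j →
        ∃ k, (i = k + 1 ∧ j = k + 2) ∨ (i = k + 2 ∧ j = k + 1) := by decide
    obtain ⟨k, ⟨rfl, rfl⟩ | ⟨rfl, rfl⟩⟩ := hindex i j hij
    · exact ⟨_, .inr ⟨k, rfl⟩, rim_inter_vertexSet b k⟩
    · exact ⟨_, .inr ⟨k, rfl⟩, (rim_inter_vertexSet b k).trans (pair_comm _ _)⟩

theorem isThreeConnected_planeGraph : (planeGraph b).IsThreeConnected :=
  PlaneGraph.isThreeConnected_of_adjGraph_eq_top (ncard_vertexSet b).ge (adjGraph_planeGraph b)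

theorem spoke_subset_support (i : Fin 3) : spoke b i ⊆ (planeGraph b).support :=
  subset_union_of_subset_right (subset_sUnion_of_mem (.inl ⟨i, rfl⟩)) _

theorem rim_subset_support (i : Fin 3) : rim b i ⊆ (planeGraph b).support :=
  subset_union_of_subset_right (subset_sUnion_of_mem (.inr ⟨i, rfl⟩)) _

theorem vertexSet_subset_iUnion_spoke : vertexSet b ⊆ ⋃ i, spoke b i := by
  rintro _ (rfl | ⟨i, rfl⟩)
  · exact mem_iUnion_of_mem 0 (left_mem_segment _ _ _)
  · exact mem_iUnion_of_mem i (right_mem_segment _ _ _)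

variable {b} in
theorem mem_spoke_or_mem_rim_of_mem_support (hz : z ∈ (planeGraph b).support) :
    (∃ i, z ∈ spoke b i) ∨ ∃ i, z ∈ rim b i := by
  obtain hz | ⟨_, ⟨i, rfl⟩ | ⟨i, rfl⟩, hz⟩ := hz
  · exact .inl (mem_iUnion.1 (vertexSet_subset_iUnion_spoke b hz))
  · exact .inl ⟨i, hz⟩
  · exact .inr ⟨i, hz⟩

theorem triangle_subset_compl_support (k : Fin 3) : triangle b k ⊆ (planeGraph b).supportᶜ := by
  rintro z ⟨hk0, hk⟩ hz
  obtain ⟨i, hi⟩ | ⟨i, hi⟩ := mem_spoke_or_mem_rim_of_mem_support hz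
  · obtain ⟨r, -, hr, hri⟩ := mem_spoke_iff.1 hi
    obtain rfl | hki := eq_or_ne k i
    · have hindex : ∀ i : Fin 3, i + 1 ≠ i := by decide
      linarith [hk _ (hindex k), hr _ (hindex k)]
    · obtain ⟨j, hji, hjk, -⟩ := exists_forall_ne_eq_or_eq i k hki.symm
      exact absurd (hk j hjk) (by rw [hr j hji, hr k hki]; exact lt_irrefl r)
  · obtain ⟨hi0, -⟩ := mem_rim_iff.1 hi
    obtain rfl | hik := eq_or_ne i k
    · exact hk0.ne' hi0
    · linarith [hk i hik]

variable {b} in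
theorem openSegment_subset_triangle (hz0 : 0 ≤ b.coord k z) (hz : ∀ j, b.coord k z ≤ b.coord j z)
    (hw : w ∈ triangle b k) : openSegment ℝ z w ⊆ triangle b k := by
  rw [openSegment_eq_image_lineMap]
  rintro _ ⟨t, ⟨ht0, ht1⟩, rfl⟩
  have hcoord (j : Fin 3) : b.coord j (AffineMap.lineMap z w t) =
      (1 - t) * b.coord j z + t * b.coord j w := by
    rw [AffineMap.apply_lineMap, AffineMap.lineMap_apply_module]
    rfl
  refine ⟨?_, fun j hj => ?_⟩
  · rw [hcoord]
    exact add_pos_of_nonneg_of_pos (mul_nonneg (by linarith) hz0) (mul_pos ht0 hw.1)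
  · rw [hcoord, hcoord]
    exact add_lt_add_of_le_of_lt (mul_le_mul_of_nonneg_left (hz j) (by linarith))
      (mul_lt_mul_of_pos_left (hw.2 j hj) ht0)

theorem convex_triangle (k : Fin 3) : Convex ℝ (triangle b k) :=
  convex_iff_openSegment_subset.2 fun _ hz _ hw =>
    openSegment_subset_triangle hz.1.le
      (fun j => (eq_or_ne j k).elim (fun h => h ▸ le_rfl) fun h => (hz.2 j h).le) hw

theorem continuous_coord (i : Fin 3) : Continuous (b.coord i) :=
  (b.coord i).continuous_of_finiteDimensional

theorem isOpen_triangle (k : Fin 3) : IsOpen (triangle b k) := by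
  simp only [triangle, Set.ofPred_and, Set.ofPred_forall]
  exact (isOpen_lt continuous_const (continuous_coord b k)).inter
    (isOpen_iInter_of_finite fun j => isOpen_iInter_of_finite fun _ =>
      isOpen_lt (continuous_coord b k) (continuous_coord b j))

theorem spokePoint_mem_triangle (k : Fin 3) : spokePoint b k (-1 / 4) ∈ triangle b k := by
  refine ⟨?_, fun j hj => ?_⟩
  · rw [coord_spokePoint_self]
    norm_num
  · rw [coord_spokePoint_self, coord_spokePoint_of_ne hj]
    norm_num

theorem closure_triangle (k : Fin 3) :
    closure (triangle b k) = {z | 0 ≤ b.coord k z ∧ ∀ j, b.coord k z ≤ b.coord j z} := by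
  refine subset_antisymm (closure_minimal (fun z hz => ⟨hz.1.le, fun j => ?_⟩) ?_) fun z hz => ?_
  · obtain rfl | hj := eq_or_ne j k
    exacts [le_rfl, (hz.2 j hj).le]
  · simp only [Set.ofPred_and, Set.ofPred_forall]
    exact (isClosed_le continuous_const (continuous_coord b k)).inter
      (isClosed_iInter fun j => isClosed_le (continuous_coord b k) (continuous_coord b j))
  · exact closure_mono (openSegment_subset_triangle hz.1 hz.2 (spokePoint_mem_triangle b k))
      (segment_subset_closure_openSegment (left_mem_segment ℝ _ _))

theorem frontier_triangle_subset (k : Fin 3) :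
    frontier (triangle b k) ⊆ (planeGraph b).support := by
  intro z hz
  rw [(isOpen_triangle b k).frontier_eq, closure_triangle] at hz
  obtain ⟨⟨hk0, hk⟩, hnot⟩ := hz
  obtain h0 | h0 := hk0.eq_or_lt
  · exact rim_subset_support b k (mem_rim_iff.2 ⟨h0.symm, fun j => hk0.trans (hk j)⟩)
  · obtain ⟨j, hjk, hj⟩ : ∃ j ≠ k, b.coord j z ≤ b.coord k z := by
      by_contra! h
      exact hnot ⟨h0, h⟩
    obtain ⟨i, -, -, hi⟩ := exists_forall_ne_eq_or_eq j k hjk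
    refine spoke_subset_support b i (mem_spoke_iff.2 ⟨b.coord k z, hk0, fun l hl => ?_, hk i⟩)
    obtain rfl | rfl := hi l hl
    exacts [hj.antisymm (hk _), rfl]

theorem triangle_mem_faces (k : Fin 3) : triangle b k ∈ (planeGraph b).faces :=
  PlaneGraph.mem_faces_of_frontier_subset_support (isOpen_triangle b k)
    (convex_triangle b k).isPreconnected ⟨_, spokePoint_mem_triangle b k⟩
    (triangle_subset_compl_support b k) (frontier_triangle_subset b k)

theorem injective_triangle : Function.Injective (triangle b) := by
  intro i j h
  by_contra hij
  have hi := spokePoint_mem_triangle b i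
  exact lt_asymm (hi.2 j (Ne.symm hij)) ((h ▸ hi : _ ∈ triangle b j).2 i hij)

variable {b} in
theorem spoke_subset_frontier_triangle (h : i ≠ k) : spoke b i ⊆ frontier (triangle b k) := by
  intro z hz
  rw [PlaneGraph.mem_frontier_iff_mem_closure_of_mem_faces (triangle_mem_faces b k)
    (spoke_subset_support b i hz), closure_triangle]
  obtain ⟨r, hr0, hr, hri⟩ := mem_spoke_iff.1 hz
  refine ⟨hr0.trans_eq (hr k h.symm).symm, fun j => (hr k h.symm).trans_le ?_⟩
  obtain rfl | hj := eq_or_ne j i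
  exacts [hri, (hr j hj).ge]

theorem spokePoint_notMem_vertexSet (i : Fin 3) (ht : t ∈ Ioo (0 : ℝ) 1) :
    spokePoint b i t ∉ vertexSet b := by
  rintro (h | ⟨j, h⟩)
  · have hcoord := congrArg (b.coord i) h
    rw [coord_spokePoint_self, coord_center] at hcoord
    linarith [ht.1]
  · rw [← spokePoint_one] at h
    exact ht.2.ne (eq_and_eq_of_spokePoint_eq one_pos ht.1 h).2.symm

/-- A point of an edge is incident with at most two faces, so besides the triangles on the two sides
of the spoke no face need be examined. -/
theorem incidentFaces_spokePoint (i : Fin 3) (ht : t ∈ Ioo (0 : ℝ) 1) :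
    (planeGraph b).incidentFaces (spokePoint b i t) = triangle b '' {i}ᶜ := by
  have hspoke := spokePoint_mem_spoke (b := b) i (Ioo_subset_Icc_self ht)
  have hle := PlaneGraph.encard_incidentFaces_le_two (spoke_subset_support b i hspoke)
    (spokePoint_notMem_vertexSet b i ht)
  have hcard : (triangle b '' {i}ᶜ).encard = 2 := by
    rw [(injective_triangle b).encard_image, ← (toFinite _).cast_ncard_eq, ncard_compl,
      ncard_singleton, Nat.card_eq_fintype_card, Fintype.card_fin]
    norm_num
  refine ((toFinite _).eq_of_subset_of_encard_le ?_ (hle.trans_eq hcard.symm)).symm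
  rintro _ ⟨k, hk, rfl⟩
  exact ⟨triangle_mem_faces b k, spoke_subset_frontier_triangle (Ne.symm hk) hspoke⟩

variable {b} in
theorem spokePoint_mem_frontier_iff {f : Set ℂ} (hf : f ∈ (planeGraph b).faces)
    (ht : t ∈ Ioo (0 : ℝ) 1) : spokePoint b i t ∈ frontier f ↔ ∃ k ≠ i, triangle b k = f := by
  have h := Set.ext_iff.1 (incidentFaces_spokePoint b i ht) f
  exact ⟨fun hi => h.1 ⟨hf, hi⟩, fun hk => (h.2 hk).2⟩

/-- The points of the spokes with index in `A` whose parameter lies in `P`. -/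
def spokePoints (A : Set (Fin 3)) (P : Set ℝ) : Set ℂ :=
  (fun p : Fin 3 × ℝ => spokePoint b p.1 p.2) '' A ×ˢ P

theorem ncard_spokePoints (A : Set (Fin 3)) (hP : P ⊆ Ioo 0 1) :
    (spokePoints b A P).ncard = A.ncard * P.ncard := by
  rw [spokePoints, InjOn.ncard_image, ncard_prod]
  rintro ⟨i, s⟩ ⟨-, hs⟩ ⟨j, t⟩ ⟨-, ht⟩ h
  exact Prod.ext_iff.2 (eq_and_eq_of_spokePoint_eq (hP hs).1 (hP ht).1 h)

theorem spokePoints_subset_iUnion_spoke (A : Set (Fin 3)) (hP : P ⊆ Ioo 0 1) :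
    spokePoints b A P ⊆ ⋃ i, spoke b i := by
  rintro _ ⟨⟨i, t⟩, ⟨-, ht⟩, rfl⟩
  exact mem_iUnion_of_mem i (spokePoint_mem_spoke i (Ioo_subset_Icc_self (hP ht)))

theorem disjoint_vertexSet_spokePoints (A : Set (Fin 3)) (hP : P ⊆ Ioo 0 1) :
    Disjoint (vertexSet b) (spokePoints b A P) := by
  rw [disjoint_right]
  rintro _ ⟨⟨i, t⟩, ⟨-, ht⟩, rfl⟩
  exact spokePoint_notMem_vertexSet b i (hP ht)

theorem spokePoints_inter_frontier_triangle (k : Fin 3) (hP : P ⊆ Ioo 0 1) :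
    spokePoints b univ P ∩ frontier (triangle b k) = spokePoints b {k}ᶜ P := by
  refine subset_antisymm ?_ ?_
  · rintro _ ⟨⟨⟨i, t⟩, ⟨-, ht⟩, rfl⟩, hz⟩
    obtain ⟨l, hl, hlk⟩ := (spokePoint_mem_frontier_iff (triangle_mem_faces b k) (hP ht)).1 hz
    exact ⟨(i, t), ⟨(injective_triangle b hlk ▸ hl).symm, ht⟩, rfl⟩
  · rintro _ ⟨⟨i, t⟩, ⟨hi, ht⟩, rfl⟩
    exact ⟨⟨(i, t), ⟨mem_univ i, ht⟩, rfl⟩,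
      spoke_subset_frontier_triangle hi (spokePoint_mem_spoke i (Ioo_subset_Icc_self (hP ht)))⟩

theorem ncard_spokePoints_inter_frontier_triangle (k : Fin 3) (hP : P ⊆ Ioo 0 1) :
    (spokePoints b univ P ∩ frontier (triangle b k)).ncard = 2 * P.ncard := by
  rw [spokePoints_inter_frontier_triangle b k hP, ncard_spokePoints b _ hP, ncard_compl,
    ncard_singleton, Nat.card_eq_fintype_card, Fintype.card_fin]

variable {b} in
theorem ncard_spokePoints_inter_frontier_le {f : Set ℂ} (hf : f ∈ (planeGraph b).faces)
    (hP : P ⊆ Ioo 0 1) : (spokePoints b univ P ∩ frontier f).ncard ≤ 2 * P.ncard := by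
  obtain h | ⟨_, ⟨⟨i, t⟩, ⟨-, ht⟩, rfl⟩, hz⟩ :=
    (spokePoints b univ P ∩ frontier f).eq_empty_or_nonempty
  · rw [h, ncard_empty]
    exact Nat.zero_le _
  · obtain ⟨k, -, rfl⟩ := (spokePoint_mem_frontier_iff hf (hP ht)).1 hz
    exact (ncard_spokePoints_inter_frontier_triangle b k hP).le

variable {b} in
theorem cyclicChromaticNumber_eq_ncard {G : PlaneGraph} (hG : G.faces = (planeGraph b).faces)
    (hV : G.verts ⊆ ⋃ i, spoke b i) : G.cyclicChromaticNumber = G.verts.ncard := by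
  refine PlaneGraph.cyclicChromaticNumber_eq_ncard fun u hu v hv => ?_
  obtain ⟨i, hi⟩ := mem_iUnion.1 (hV hu)
  obtain ⟨j, hj⟩ := mem_iUnion.1 (hV hv)
  have hindex : ∀ i j : Fin 3, ∃ k, i ≠ k ∧ j ≠ k := by decide
  obtain ⟨k, hik, hjk⟩ := hindex i j
  exact ⟨triangle b k, hG ▸ triangle_mem_faces b k, spoke_subset_frontier_triangle hik hi,
    spoke_subset_frontier_triangle hjk hj⟩

theorem exists_isSubdivision_isGreatest_degreeDifferences (a : ℕ) :
    ∃ G : PlaneGraph, G.IsSubdivision (planeGraph b) ∧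
      IsGreatest (G.degreeDifferences (planeGraph b)) (2 * (a : ℤ)) ∧
      G.cyclicChromaticNumber = 3 * a + (planeGraph b).cyclicChromaticNumber := by
  obtain ⟨P, hP, hPfin, rfl⟩ := (Ioo_infinite (zero_lt_one (α := ℝ))).exists_subset_ncard_eq a
  have hfin : (spokePoints b univ P).Finite := (finite_univ.prod hPfin).image _
  have hspoke := spokePoints_subset_iUnion_spoke b univ hP
  have hdisj := disjoint_vertexSet_spokePoints b univ hP
  obtain ⟨G, hG, hV⟩ := (planeGraph b).exists_isSubdivision hfin
    (hspoke.trans (iUnion_subset (spoke_subset_support b)))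
  change G.verts = vertexSet b ∪ spokePoints b univ P at hV
  have hnew : G.verts \ (planeGraph b).verts = spokePoints b univ P := by
    rw [hV]
    exact hdisj.sup_sdiff_cancel_left
  have hdiff (f : Set ℂ) : (G.faceDegree f : ℤ) - (planeGraph b).faceDegree f =
      (spokePoints b univ P ∩ frontier f).ncard := by
    rw [PlaneGraph.faceDegree_sub_faceDegree hG.verts_subset, hnew]
  refine ⟨G, hG, ⟨⟨triangle b 0, hG.faces_eq ▸ triangle_mem_faces b 0, ?_⟩, ?_⟩, ?_⟩
  · rw [hdiff, ncard_spokePoints_inter_frontier_triangle b 0 hP]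
    push_cast
    rfl
  · rintro _ ⟨f, hf, rfl⟩
    rw [hdiff]
    exact_mod_cast ncard_spokePoints_inter_frontier_le (hG.faces_eq ▸ hf) hP
  · have hVR := vertexSet_subset_iUnion_spoke b
    rw [cyclicChromaticNumber_eq_ncard hG.faces_eq (hV ▸ union_subset hVR hspoke),
      cyclicChromaticNumber_eq_ncard rfl hVR, hV,
      ncard_union_eq hdisj ((planeGraph b).verts_finite) hfin, ncard_spokePoints b _ hP,
      ncard_univ, Nat.card_eq_fintype_card, Fintype.card_fin]
    exact add_comm _ _

end Tetrahedron

theorem theorem7_general :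
    (∀ R G : PlaneGraph, G.IsSubdivision R →
      ∃ M : ℤ, IsGreatest (G.degreeDifferences R) M ∧
        (G.cyclicChromaticNumber : ℤ) ≤ ⌊(3 / 2 : ℝ) * (M : ℝ)⌋ + (R.cyclicChromaticNumber : ℤ)) ∧
    (∀ a : ℕ,
      ∃ R G : PlaneGraph, R.IsThreeConnected ∧ R.IsSimple ∧ G.IsSubdivision R ∧
        ∃ M : ℤ, M = 2 * (a : ℤ) ∧ IsGreatest (G.degreeDifferences R) M ∧
          (G.cyclicChromaticNumber : ℤ) =
            ⌊(3 / 2 : ℝ) * (M : ℝ)⌋ + (R.cyclicChromaticNumber : ℤ)) := by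
  refine ⟨fun R G hG => ?_, fun a => ?_⟩
  · obtain ⟨M, hM⟩ := hG.exists_isGreatest
    refine ⟨M, hM, ?_⟩
    rw [PlaneGraph.floor_three_halves_mul]
    exact_mod_cast hG.cyclicChromaticNumber_le hM.2
  · obtain ⟨b⟩ : Nonempty (AffineBasis (Fin 3) ℝ ℂ) :=
      AffineBasis.exists_affineBasis_of_finiteDimensional (by simp [Complex.finrank_real_complex])
    obtain ⟨G, hG, hM, hχ⟩ := Tetrahedron.exists_isSubdivision_isGreatest_degreeDifferences b a
    refine ⟨Tetrahedron.planeGraph b, G, Tetrahedron.isThreeConnected_planeGraph b,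
      Tetrahedron.isSimple_planeGraph b, hG, 2 * (a : ℤ), rfl, hM, ?_⟩
    have hfloor := PlaneGraph.floor_three_halves_mul (2 * a)
    rw [show 3 * (2 * a) / 2 = 3 * a by omega] at hfloor
    rw [hχ]
    exact_mod_cast congrArg (· + ((Tetrahedron.planeGraph b).cyclicChromaticNumber : ℤ)) hfloor.symm

theorem theorem7 :
    (∀ R G : PlaneGraph, R.IsThreeConnected → G.IsSubdivision R →
      ∃ M : ℤ, IsGreatest (G.degreeDifferences R) M ∧
        (G.cyclicChromaticNumber : ℤ) ≤ ⌊(3 / 2 : ℝ) * (M : ℝ)⌋ + (R.cyclicChromaticNumber : ℤ)) ∧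
    (∀ a : ℕ, 2 ≤ a →
      ∃ R G : PlaneGraph, R.IsThreeConnected ∧ R.IsSimple ∧ G.IsSubdivision R ∧
        ∃ M : ℤ, M = 2 * (a : ℤ) ∧ IsGreatest (G.degreeDifferences R) M ∧
          (G.cyclicChromaticNumber : ℤ) =
            ⌊(3 / 2 : ℝ) * (M : ℝ)⌋ + (R.cyclicChromaticNumber : ℤ)) :=
  ⟨fun R G _ => theorem7_general.1 R G, fun a _ => theorem7_general.2 a⟩
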